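/- Let $n\ge 0$ and let $\mu=(\mu_1\ge\mu_2\ge\cdots\ge\mu_n\ge 0)$ be a partition with at most $n$ parts. Put $\delta=(n,n-1,\ldots,1)$ and $\lambda=\mu+\delta$, i.e. $\lambda_i=\mu_i+n+1-i$. Let $x=(x_1,\ldots,x_n)$, $y=(y_1,\ldots,y_n)$ and $a=(a_0,a_1,a_2,\ldots)$ be elements of a commutative ring (for instance independent indeterminates). Definitions. Let $F^\mu=\{(i,j):1\le i\le n,\ 1\le j\le\mu_i\}$ and let $\mathcal T^\mu$ be the set of semistandard tableaux of shape $\mu$ with entries in $\{1,\ldots,n\}$ (fillings $T=(T_{ij})$ of $F^\mu$ weakly increasing along rows and strictly increasing down columns). The factorial Schur function is $$s_\mu(x|a)=\sum_{T\in\mathcal T^\mu}\ \prod_{(i,j)\in F^\mu}\bigl(x_{T_{ij}}+a_{T_{ij}+j-i}\bigr).$$ For a strict partition $\lambda=(\lambda_1>\cdots>\lambda_n)$ let $SF^\lambda=\{(i,j):1\le i\le n,\ i\le j\le i+\lambda_i-1\}$ be the shifted diagram. A primed shifted tableau of shape $\lambda$ is a filling $P=(p_{ij})$ of $SF^\lambda$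 with letters of the ordered alphabet $1'<1<2'<2<\cdots<n'<n$ such that the entries weakly increase along rows and down columns, each primed letter $k'$ occurs at most once in every row, and each unprimed letter $k$ occurs at most once in every column. Let $\mathcal Q^\lambda$ be the set of all of these, and $\mathcal P^\lambda\subseteq\mathcal Q^\lambda$ the subset of those with no primed letter on the main diagonal $i=j$. Define $$Q_\lambda(x;y|a)=\sum_{P\in\mathcal Q^\lambda}\ \prod_{(i,j)\in SF^\lambda} w_{ij}(p_{ij}),\qquad w_{ij}(k)=x_k+a_{j-i},\quad w_{ij}(k')=y_k-a_{j-i},$$ and let $P_\lambda(x;y|a)$ be the same sum restricted to $P\in\mathcal P^\lambda$, with $a_0$ replaced by $0$. Theorem. The sequence $\lambda=\mu+\delta$ is a strict partition with exactly $n$ (positive) parts, and $$P_\lambda(x;y|a)=\prod_{1\le i\le n}x_i\ \prod_{1\le i<j\le n}(x_i+y_j)\ s_\mu(x|a),$$ $$Q_\lambda(x;y|a)=\prod_{1\le i\le j\le n}(x_i+y_j)\ s_\mu(x|a).$$ -/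

import Mathlib

namespace FactorialSchur

/-! Rows, columns and letters are numbered from `0`, as in `YoungDiagram`: the letters
`1, …, n` are the elements `0, …, n - 1` of `Fin n`. The sequence `a` keeps its own indices
`a 0, a 1, a 2, …`. -/

/-- Semistandard tableaux of shape `μ` with all entries in the `n`-letter alphabet. -/
abbrev BoundedSSYT (n : ℕ) (μ : YoungDiagram) : Type :=
  {T : SemistandardYoungTableau μ // ∀ i j : ℕ, (i, j) ∈ μ → T i j < n}

instance boundedSSYT_finite (n : ℕ) (μ : YoungDiagram) : Finite (BoundedSSYT n μ) := by
  refine Finite.of_injective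
    (fun (T : BoundedSSYT n μ) (c : μ.cells) =>
      (⟨T.1 c.1.1 c.1.2, T.2 c.1.1 c.1.2 c.2⟩ : Fin n)) ?_
  intro T T' h
  refine Subtype.ext (SemistandardYoungTableau.ext fun i j => ?_)
  by_cases hc : (i, j) ∈ μ
  · have := congrFun h ⟨(i, j), hc⟩
    simpa using this
  · rw [T.1.zeros hc, T'.1.zeros hc]

noncomputable instance boundedSSYT_fintype (n : ℕ) (μ : YoungDiagram) :
    Fintype (BoundedSSYT n μ) :=
  Fintype.ofFinite _

/-- The factorial Schur function `s_μ(x|a)`: the sum over semistandard tableaux `T` of the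
product over the boxes `(i, j)` of `x_k + a_{k + j - i}`, where `k = T_{ij}`.
In that index `k`, `i`, `j` are counted from `1`, whence the `+ 1`s; the subtraction never
truncates because the entries of a column-strict `T` satisfy `T i j ≥ i`. -/
noncomputable def factorialSchur {R : Type*} [CommRing R] {n : ℕ} (μ : YoungDiagram)
    (x : Fin n → R) (a : ℕ → R) : R :=
  ∑ T : BoundedSSYT n μ, ∏ c : μ.cells,
    (x ⟨T.1 c.1.1 c.1.2, T.2 c.1.1 c.1.2 c.2⟩
      + a ((T.1 c.1.1 c.1.2 + 1) + (c.1.2 + 1) - (c.1.1 + 1)))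

/-- The shifted Young diagram of `lam = (lam 0 > lam 1 > ⋯)`: row `i` consists of the boxes in
the columns `i, i + 1, …, i + lam i - 1`. A box `b` has row `b.1` and column `b.2`. -/
def shiftedDiagram {n : ℕ} (lam : Fin n → ℕ) : Finset (Σ _ : Fin n, ℕ) :=
  Finset.univ.sigma fun i : Fin n => Finset.Ico (i : ℕ) ((i : ℕ) + lam i)

/-- The ordered alphabet `1' < 1 < 2' < 2 < ⋯ < n' < n`: the pair `(k, false)` is the primed
letter `k'`, the pair `(k, true)` is the unprimed letter `k`. -/
abbrev PrimedAlphabet (n : ℕ) : Type := Fin n ×ₗ Bool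

/-- The letter is primed. -/
def IsPrimed {n : ℕ} (c : PrimedAlphabet n) : Prop := (ofLex c).2 = false

instance {n : ℕ} (c : PrimedAlphabet n) : Decidable (IsPrimed c) :=
  inferInstanceAs (Decidable ((ofLex c).2 = false))

/-- The filling `p` of the shifted diagram of `lam` is a primed shifted tableau: entries weakly
increase along rows and down columns, each primed letter appears at most once in every row, and
each unprimed letter appears at most once in every column. -/
def IsPrimedShiftedTableau {n : ℕ} {lam : Fin n → ℕ}
    (p : shiftedDiagram lam → PrimedAlphabet n) : Prop :=
  (∀ b c : shiftedDiagram lam, b.1.1 = c.1.1 → b.1.2 ≤ c.1.2 → p b ≤ p c) ∧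
  (∀ b c : shiftedDiagram lam, b.1.2 = c.1.2 → b.1.1 ≤ c.1.1 → p b ≤ p c) ∧
  (∀ b c : shiftedDiagram lam, b.1.1 = c.1.1 → p b = p c → IsPrimed (p b) → b = c) ∧
  (∀ b c : shiftedDiagram lam, b.1.2 = c.1.2 → p b = p c → ¬ IsPrimed (p b) → b = c)

instance {n : ℕ} {lam : Fin n → ℕ} (p : shiftedDiagram lam → PrimedAlphabet n) :
    Decidable (IsPrimedShiftedTableau p) := by
  unfold IsPrimedShiftedTableau
  refine @instDecidableAnd _ _ ?_ (@instDecidableAnd _ _ ?_ (@instDecidableAnd _ _ ?_ ?_)) <;>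
    infer_instance

/-- No primed entry lies on the main diagonal. -/
def DiagonalUnprimed {n : ℕ} {lam : Fin n → ℕ}
    (p : shiftedDiagram lam → PrimedAlphabet n) : Prop :=
  ∀ b : shiftedDiagram lam, b.1.2 = (b.1.1 : ℕ) → ¬ IsPrimed (p b)

instance {n : ℕ} {lam : Fin n → ℕ} (p : shiftedDiagram lam → PrimedAlphabet n) :
    Decidable (DiagonalUnprimed p) := by
  unfold DiagonalUnprimed; infer_instance

/-- The weight of a letter with shift `t`: `x_k + t` for `k` and `y_k - t` for `k'`. -/
def letterWeight {R : Type*} [CommRing R] {n : ℕ} (x y : Fin n → R) (t : R)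
    (c : PrimedAlphabet n) : R :=
  if IsPrimed c then y (ofLex c).1 - t else x (ofLex c).1 + t

/-- The weight of a filling of a shifted diagram: the product over the boxes `(i, j)` of
`x_k + a_{j - i}` for an entry `k`, and of `y_k - a_{j - i}` for an entry `k'`. -/
def tableauWeight {R : Type*} [CommRing R] {n : ℕ} {lam : Fin n → ℕ} (x y : Fin n → R)
    (a : ℕ → R) (p : shiftedDiagram lam → PrimedAlphabet n) : R :=
  ∏ b : shiftedDiagram lam, letterWeight x y (a (b.1.2 - (b.1.1 : ℕ))) (p b)

/-- The factorial generalised Schur `Q`-function `Q_lam(x; y | a)`. -/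
def factorialQ {R : Type*} [CommRing R] {n : ℕ} (lam : Fin n → ℕ) (x y : Fin n → R)
    (a : ℕ → R) : R :=
  ∑ p : shiftedDiagram lam → PrimedAlphabet n with IsPrimedShiftedTableau p,
    tableauWeight x y a p

/-- The factorial generalised Schur `P`-function `P_lam(x; y | a)`, in whose definition `a_0` is
set equal to `0`. -/
def factorialP {R : Type*} [CommRing R] {n : ℕ} (lam : Fin n → ℕ) (x y : Fin n → R)
    (a : ℕ → R) : R :=
  ∑ p : shiftedDiagram lam → PrimedAlphabet n with
    IsPrimedShiftedTableau p ∧ DiagonalUnprimed p,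
    tableauWeight x y (Function.update a 0 0) p

/-- `μ + δ` with `δ = (n, n - 1, …, 1)`. -/
def addStaircase (n : ℕ) (μ : YoungDiagram) : Fin n → ℕ :=
  fun i => μ.rowLen i + (n - (i : ℕ))

end FactorialSchur

/-!
Both sides are written as determinants. Let `(z|a)^k = (z + a 1) ⋯ (z + a (k - 1))`, let
`A_m(r) = det ((x_j|a)^{r_i})` be the alternant of size `m`, and let `V_m` be the Vandermonde
product of the first `m` variables.

Removing the boxes with the largest letter from a tableau leaves a tableau of a smaller shape with
one letter less (`fillingSum_succ`), and for a diagram given by its row lengths the removed boxes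
form a strip described by interlacing inequalities (`isStrip_sameCol_iff`, `isStrip_sameRow_iff`).
For semistandard tableaux this is the branching rule `schurSum_succ`. The same recursion holds for
alternants (`alternant_succ`): multiply the columns by `x_j - x_m`, so that the row sums telescope,
and expand along the last column. Hence `V_n s_μ(x|a) = A_n(μ + δ)`.

For primed shifted tableaux, the letters of index `m` (counted from `0`) are removed in two steps.
The unprimed letter leaves a shape `ρ` with `λ_{i+1} < ρ_i ≤ λ_i`, with the weights of the branching
rule at `k_i = ρ_i - 1`. The primed letter removes at most one box from each row, and because
`(z + u) (z|a)^k = (z|a)^{k+1} + (u - a_k) (z|a)^k`, the sum over the resulting strict shapes turns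
alternants into the alternant at `ρ - 1` times `∏_{j < m} (x_j + y_m)`
(`prod_add_mul_alternant`; shapes with two equal rows contribute vanishing alternants). The
diagonal box of row `m` contributes the sum of its two weights. By induction the generating
function times `V_n` is the alternant `A_n(λ)` times
`∏_k (d_k + d'_k) ∏_{j < k} (x_j + y_k)`, where `d_k` and `d'_k` are the weights of `k` and `k'` on
the diagonal. The choices `d_k = x_k + a_0`, `d'_k = y_k - a_0` and `d_k = x_k`, `d'_k = 0` give
`Q` and `P`. Finally `V_n` is cancelled in a polynomial ring, where it is not a zero divisor, and
the identity is specialised.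
-/

namespace FactorialSchur
open Finset

/-! ### Fillings and removal of the largest letter -/

section Filling
variable {α : Type*} {R : Type*} [CommRing R]

/-- `p` is a filling of the boxes `D`: it is monotone for the relation `L` on boxes, and two
different boxes related by `E k` do not both carry the letter `k`. -/
def IsFilling (L : α → α → Prop) (E : ℕ → α → α → Prop) (D : Finset α) (p : α → ℕ) : Prop :=
  (∀ b ∈ D, ∀ c ∈ D, L b c → p b ≤ p c) ∧
    ∀ b ∈ D, ∀ c ∈ D, p b = p c → E (p b) b c → b = c

/-- The boxes of `D` outside `D'` can be filled with one letter, larger than all the letters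
in `D'`: the set `D'` is a lower set of `D` for `L`, and no two boxes outside are related
by `E`. -/
def IsStrip (L : α → α → Prop) (E : α → α → Prop) (D' D : Finset α) : Prop :=
  (∀ b ∈ D, ∀ c ∈ D', L b c → b ∈ D') ∧
    ∀ b ∈ D, b ∉ D' → ∀ c ∈ D, c ∉ D' → E b c → b = c

open scoped Classical in
/-- The generating function of the fillings of `D` with letters `0, …, N - 1`, where the letter `k`
in the box `b` has the weight `w k b`. Fillings are extended by `0` outside `D`. -/
noncomputable def fillingSum (L : α → α → Prop) (E : ℕ → α → α → Prop) (w : ℕ → α → R)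
    (N : ℕ) (D : Finset α) : R :=
  ∑ p ∈ (D.finsupp fun _ => range N).filter fun p : α →₀ ℕ => IsFilling L E D p,
    ∏ b ∈ D, w (p b) b

variable (L : α → α → Prop) (E : ℕ → α → α → Prop) (w : ℕ → α → R)

theorem fillingSum_zero_of_mem {D : Finset α} {b : α} (hb : b ∈ D) :
    fillingSum L E w 0 D = 0 := by
  refine sum_eq_zero fun p hp => ?_
  simp only [mem_filter, mem_finsupp_iff] at hp
  simpa using hp.1.2 b hb

theorem fillingSum_empty (N : ℕ) : fillingSum L E w N ∅ = 1 := by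
  classical
  have : (∅ : Finset α).finsupp (fun _ => range N) = {0} := by
    ext p
    simp [mem_finsupp_iff]
  simp [fillingSum, this, IsFilling, Finset.filter_singleton]

theorem map_fillingSum {S : Type*} [CommRing S] (f : R →+* S) (N : ℕ) (D : Finset α) :
    f (fillingSum L E w N D) = fillingSum L E (fun k b => f (w k b)) N D := by
  simp [fillingSum, map_sum, map_prod]

open scoped Classical in
/-- Removal of the boxes that carry the largest letter. -/
theorem fillingSum_succ [DecidableEq α] (N : ℕ) (D : Finset α) :
    fillingSum L E w (N + 1) D =
      ∑ D' ∈ D.powerset with IsStrip L (E N) D' D,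
        (∏ b ∈ D \ D', w N b) * fillingSum L E w N D' := by
  -- the boxes with letters below `N` are the complement of a strip
  have hmap : ∀ p ∈ (D.finsupp fun _ => range (N + 1)).filter
        fun p : α →₀ ℕ => IsFilling L E D p,
      D.filter (fun b => p b < N) ∈ D.powerset.filter (fun D' => IsStrip L (E N) D' D) := by
    intro p hp
    simp only [mem_filter, mem_finsupp_iff, mem_range] at hp
    obtain ⟨⟨-, hN⟩, hL, hE⟩ := hp
    simp only [mem_filter, mem_powerset, filter_subset, true_and]
    refine ⟨fun b hb c hc hbc => ?_, fun b hb hb' c hc hc' hbc => ?_⟩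
    · simp only [mem_filter] at hc ⊢
      exact ⟨hb, (hL b hb c hc.1 hbc).trans_lt hc.2⟩
    · simp only [mem_filter, hb, hc, true_and, not_lt] at hb' hc'
      have h1 : p b = N := by have := hN b hb; omega
      have h2 : p c = N := by have := hN c hc; omega
      exact hE b hb c hc (h1.trans h2.symm) (h1 ▸ hbc)
  rw [fillingSum, ← sum_fiberwise_of_maps_to hmap]
  refine sum_congr rfl fun D' hD' => ?_
  simp only [mem_filter, mem_powerset] at hD'
  obtain ⟨hsub, hlow, hstrip⟩ := hD'
  rw [fillingSum, mul_sum]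
  refine sum_bij' (fun p _ => Finsupp.onFinset D' (fun b => if b ∈ D' then p b else 0) ?_)
    (fun p _ => Finsupp.onFinset D
      (fun b => if b ∈ D' then p b else if b ∈ D then N else 0) ?_) ?_ ?_ ?_ ?_ ?_
  · intro b hb
    by_contra h
    simp [h] at hb
  · intro b hb
    by_contra h
    have : b ∉ D' := fun h' => h (hsub h')
    simp [h, this] at hb
  · intro p hp
    simp only [mem_filter, mem_finsupp_iff, mem_range] at hp
    obtain ⟨⟨⟨-, hN⟩, hL, hE⟩, rfl⟩ := hp
    simp only [mem_filter, mem_finsupp_iff, mem_range]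
    refine ⟨⟨Finsupp.support_onFinset_subset, fun b hb => ?_⟩, fun b hb c hc hbc => ?_,
      fun b hb c hc hbc hE' => ?_⟩
    · simp only [Finsupp.onFinset_apply, if_pos hb]
      exact hb.2
    · simp only [mem_filter] at hb hc
      simpa [hb, hc] using hL b hb.1 c hc.1 hbc
    · simp only [mem_filter] at hb hc
      simp only [Finsupp.onFinset_apply, if_pos hb, if_pos hc] at hbc hE'
      exact hE b hb.1 c hc.1 hbc hE'
  · intro p hp
    simp only [mem_filter, mem_finsupp_iff, mem_range] at hp
    obtain ⟨⟨-, hN⟩, hL, hE⟩ := hp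
    simp only [mem_filter, mem_finsupp_iff, mem_range]
    refine ⟨⟨⟨Finsupp.support_onFinset_subset, fun b hb => ?_⟩, fun b hb c hc hbc => ?_,
      fun b hb c hc hbc hE' => ?_⟩, ?_⟩
    · simp only [Finsupp.onFinset_apply]
      split_ifs with h
      · exact (hN b h).trans (Nat.lt_succ_self N)
      · exact Nat.lt_succ_self N
    · simp only [Finsupp.onFinset_apply, if_pos hb, if_pos hc]
      split_ifs with h h' h'
      · exact hL b h c h' hbc
      · exact (hN b h).le
      · exact absurd (hlow b hb c h' hbc) h
      · exact le_rfl
    · simp only [Finsupp.onFinset_apply, if_pos hb, if_pos hc] at hbc hE'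
      split_ifs at hbc hE' with h h' h'
      · exact hE b h c h' hbc hE'
      · exact absurd hbc (hN b h).ne
      · exact absurd hbc.symm (hN c h').ne
      · exact hstrip b hb h c hc h' hE'
    · ext b
      rw [mem_filter, Finsupp.onFinset_apply]
      constructor
      · rintro ⟨hb, h⟩
        by_contra h'
        simp [hb, h'] at h
      · intro h
        exact ⟨hsub h, by simpa [h] using hN b h⟩
  · intro p hp
    simp only [mem_filter, mem_finsupp_iff, mem_range] at hp
    obtain ⟨⟨⟨hs, hN⟩, -, -⟩, rfl⟩ := hp
    ext b
    by_cases hb : b ∈ D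
    · have := hN b hb
      by_cases h : p b < N
      · simp [hb, h]
      · simp [hb, h]
        omega
    · have : p b = 0 := by
        by_contra h
        exact hb (hs (by simpa using h))
      simp [hb, this]
  · intro p hp
    simp only [mem_filter, mem_finsupp_iff, mem_range] at hp
    obtain ⟨⟨hs, -⟩, -, -⟩ := hp
    ext b
    by_cases hb : b ∈ D'
    · simp [hb]
    · have : p b = 0 := by
        by_contra h
        exact hb (hs (by simpa using h))
      simp [hb, this]
  · intro p hp
    simp only [mem_filter, mem_finsupp_iff, mem_range] at hp
    obtain ⟨⟨⟨hs, hN⟩, -, -⟩, rfl⟩ := hp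
    rw [← prod_sdiff hsub]
    congr 1
    · refine prod_congr rfl fun b hb => ?_
      simp only [mem_sdiff, mem_filter, not_and, not_lt] at hb
      have h1 := hN b hb.1
      have h2 := hb.2 hb.1
      rw [show p b = N by omega]
    · refine prod_congr rfl fun b hb => ?_
      rw [Finsupp.onFinset_apply, if_pos hb]

/-- A diagram with a chain of `N + 1` boxes in which the letter `t` is forbidden to occur in both
the boxes number `t` and `t + 1` cannot be filled with `N` letters. -/
theorem fillingSum_eq_zero_of_chain (c : ℕ → α) (hL : ∀ t, L (c t) (c (t + 1)))
    (hE : ∀ t, E t (c t) (c (t + 1))) (hne : ∀ t, c t ≠ c (t + 1)) (N : ℕ) :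
    ∀ D : Finset α, (∀ t ≤ N, c t ∈ D) → fillingSum L E w N D = 0 := by
  classical
  induction N with
  | zero => exact fun D hD => fillingSum_zero_of_mem L E w (hD 0 le_rfl)
  | succ N ih =>
    intro D hD
    rw [fillingSum_succ]
    refine sum_eq_zero fun D' hD' => ?_
    simp only [mem_filter, mem_powerset] at hD'
    obtain ⟨-, hlow, hstrip⟩ := hD'
    have hN : c N ∈ D' := by
      by_contra hN
      have hN' : c (N + 1) ∉ D' := fun h => hN (hlow _ (hD N N.le_succ) _ h (hL N))
      exact hne N (hstrip _ (hD N N.le_succ) hN _ (hD _ le_rfl) hN' (hE N))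
    rw [ih D' fun t ht => ?_, mul_zero]
    induction ht using Nat.decreasingInduction with
    | self => exact hN
    | of_succ t ht h => exact hlow _ (hD t (by omega)) _ h (hL t)

end Filling

/-! ### Factorial alternants -/

section Det
variable {R : Type*} [CommRing R]

/-- The shifted power `(z + a 1) ⋯ (z + a (k - 1))`. It has `k - 1` factors: the exponents that
occur are the row lengths of the shifted diagram, whose diagonal boxes are weighted separately. -/
def shiftedPow (a : ℕ → R) (z : R) (k : ℕ) : R := ∏ c ∈ Ico 1 k, (z + a c)

/-- The determinant whose entry in row `i` and column `j` is `(x_j + a 1) ⋯ (x_j + a (r i - 1))`. -/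
noncomputable def alternant (x a : ℕ → R) {m : ℕ} (r : Fin m → ℕ) : R :=
  Matrix.det (Matrix.of fun i j : Fin m => shiftedPow a (x j) (r i))

/-- The Vandermonde product of `x 0, …, x (m - 1)`. -/
def vandermondeProd (x : ℕ → R) (m : ℕ) : R := ∏ k ∈ range m, ∏ j ∈ range k, (x j - x k)

variable (x a : ℕ → R)

theorem shiftedPow_succ (z : R) {k : ℕ} (hk : 1 ≤ k) :
    shiftedPow a z (k + 1) = shiftedPow a z k * (z + a k) :=
  prod_Ico_succ_top hk _

theorem shiftedPow_mul_prod (z : R) {k l : ℕ} (hk : 1 ≤ k) (hl : k ≤ l) :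
    shiftedPow a z k * ∏ c ∈ Ico k l, (z + a c) = shiftedPow a z l :=
  prod_Ico_consecutive _ hk hl

theorem alternant_eq_zero {m : ℕ} {r : Fin m → ℕ} (h : ¬ Function.Injective r) :
    alternant x a r = 0 := by
  simp only [Function.Injective, not_forall] at h
  obtain ⟨i, j, hij, hne⟩ := h
  exact Matrix.det_zero_of_row_eq hne (by ext k; simp [hij])

/-- Alternants are multilinear in their rows. -/
theorem det_sum_shiftedPow {m : ℕ} (s : Fin m → Finset ℕ) (c : Fin m → ℕ → R) :
    Matrix.det (Matrix.of fun i j : Fin m => ∑ k ∈ s i, c i k * shiftedPow a (x j) k) =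
      ∑ k ∈ Fintype.piFinset s, (∏ i, c i (k i)) * alternant x a k := by
  have h := (Matrix.detRowAlternating (R := R) (n := Fin m)).toMultilinearMap.map_sum_finset
    (fun i k => c i k • fun j : Fin m => shiftedPow a (x j) k) s
  simp only [MultilinearMap.map_smul_univ] at h
  simp only [smul_eq_mul] at h
  refine Eq.trans ?_ h
  refine congrArg Matrix.det ?_
  ext i j
  simp [Finset.sum_apply]

/-- Subtracting multiples of the next row from every row but the last does not change the
determinant. -/
theorem det_eq_of_forall_row_eq_smul_add_succ {m : ℕ}
    {A B : Matrix (Fin (m + 1)) (Fin (m + 1)) R} (c : Fin m → R)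
    (A_last : ∀ j, A (Fin.last m) j = B (Fin.last m) j)
    (A_castSucc : ∀ (i : Fin m) (j), A i.castSucc j = B i.castSucc j + c i * A i.succ j) :
    A.det = B.det := by
  rw [← Matrix.det_submatrix_equiv_self Fin.revPerm A,
    ← Matrix.det_submatrix_equiv_self Fin.revPerm B]
  refine Matrix.det_eq_of_forall_row_eq_smul_add_pred (fun i => c i.rev) (fun j => ?_)
    fun i j => ?_
  · simpa using A_last j.rev
  · simpa [Fin.rev_succ, Fin.rev_castSucc] using A_castSucc i.rev j.rev

theorem sum_prod_mul_sub_mul_shiftedPow (z t : R) {p q : ℕ} (hp : 1 ≤ p) (hpq : p ≤ q) :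
    ∑ k ∈ Ico p q, (∏ c ∈ Ico (k + 1) q, (t + a c)) * ((z - t) * shiftedPow a z k) =
      shiftedPow a z q - (∏ c ∈ Ico p q, (t + a c)) * shiftedPow a z p := by
  induction q, hpq using Nat.le_induction with
  | base => simp
  | succ q hpq ih =>
    rw [sum_Ico_succ_top hpq, prod_Ico_succ_top hpq, shiftedPow_succ a z (hp.trans hpq)]
    have : ∑ k ∈ Ico p q, (∏ c ∈ Ico (k + 1) (q + 1), (t + a c)) * ((z - t) * shiftedPow a z k)
        = (∑ k ∈ Ico p q, (∏ c ∈ Ico (k + 1) q, (t + a c)) * ((z - t) * shiftedPow a z k)) *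
          (t + a q) := by
      rw [sum_mul]
      refine sum_congr rfl fun k hk => ?_
      rw [prod_Ico_succ_top (Nat.succ_le_of_lt (mem_Ico.1 hk).2)]
      ring
    rw [this, ih]
    simp
    ring

theorem prod_mul_alternant (u : ℕ → R) {m : ℕ} (k : Fin m → ℕ) :
    (∏ j ∈ range m, u j) * alternant x a k =
      Matrix.det (Matrix.of fun i j : Fin m => u j * shiftedPow a (x j) (k i)) := by
  rw [← Fin.prod_univ_eq_prod_range, alternant]
  exact (Matrix.det_mul_row (fun j : Fin m => u j) _).symm

/-- Expansion of an alternant in `m + 1` variables in terms of alternants in the first `m`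
variables: the bialternant counterpart of the branching rule. -/
theorem alternant_succ {m : ℕ} (r : Fin (m + 1) → ℕ) (hr : Antitone r) (hpos : ∀ i, 1 ≤ r i) :
    (∏ j ∈ range m, (x j - x m)) *
      ∑ k ∈ Fintype.piFinset (fun i : Fin m => Ico (r i.succ) (r i.castSucc)),
        (∏ i, ∏ c ∈ Ico (k i + 1) (r i.castSucc), (x m + a c)) *
          shiftedPow a (x m) (r (Fin.last m)) * alternant x a k = alternant x a r := by
  set q : Fin m → R := fun i => ∏ c ∈ Ico (r i.succ) (r i.castSucc), (x m + a c)
  have hle : ∀ i : Fin m, r i.succ ≤ r i.castSucc := fun i => hr (Fin.castSucc_lt_succ).le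
  -- subtracting `q i` times the next row from row `i` clears the last column above its last entry
  set A : Matrix (Fin (m + 1)) (Fin (m + 1)) R :=
    Matrix.of fun i j => shiftedPow a (x j) (r i) with hA
  set B : Matrix (Fin (m + 1)) (Fin (m + 1)) R :=
    Matrix.of (Fin.lastCases (A (Fin.last m)) fun i j => A i.castSucc j - q i * A i.succ j) with hB
  have hAB : A.det = B.det := by
    refine det_eq_of_forall_row_eq_smul_add_succ q (fun j => ?_) fun i j => ?_
    · simp [hB]
    · simp [hB]
  have hzero : ∀ i : Fin m, B i.castSucc (Fin.last m) = 0 := by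
    intro i
    simp only [hB, hA, Matrix.of_apply, Fin.lastCases_castSucc, Fin.val_last, q]
    rw [← shiftedPow_mul_prod a (x m) (hpos i.succ) (hle i)]
    ring
  have hexp : B.det = shiftedPow a (x m) (r (Fin.last m)) *
      Matrix.det (B.submatrix Fin.castSucc Fin.castSucc) := by
    rw [Matrix.det_succ_column B (Fin.last m), Fin.sum_univ_castSucc]
    simp only [hzero, mul_zero, zero_mul, sum_const_zero, zero_add, Fin.succAbove_last]
    rw [← two_mul, pow_mul]
    simp [hB, hA]
  have hsub : B.submatrix Fin.castSucc Fin.castSucc = Matrix.of fun i j : Fin m =>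
      ∑ k ∈ Ico (r i.succ) (r i.castSucc),
        (∏ c ∈ Ico (k + 1) (r i.castSucc), (x m + a c)) *
          ((x j - x m) * shiftedPow a (x j) k) := by
    ext i j
    rw [Matrix.of_apply, sum_prod_mul_sub_mul_shiftedPow a _ _ (hpos _) (hle i)]
    simp [hB, hA, q]
  have hfac : Matrix.det (B.submatrix Fin.castSucc Fin.castSucc) =
      (∏ j ∈ range m, (x j - x m)) * Matrix.det (Matrix.of fun i j : Fin m =>
        ∑ k ∈ Ico (r i.succ) (r i.castSucc),
          (∏ c ∈ Ico (k + 1) (r i.castSucc), (x m + a c)) * shiftedPow a (x j) k) := by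
    rw [hsub, ← Fin.prod_univ_eq_prod_range (fun j => x j - x m),
      ← Matrix.det_mul_row (fun j : Fin m => x j - x m)]
    congr 1
    ext i j
    simp only [Matrix.of_apply, mul_sum]
    exact sum_congr rfl fun k _ => by ring
  have hAr : alternant x a r = A.det := rfl
  rw [hAr, hAB, hexp, hfac, det_sum_shiftedPow x a _
    (fun i k => ∏ c ∈ Ico (k + 1) (r i.castSucc), (x m + a c))]
  simp only [mul_sum]
  exact sum_congr rfl fun k _ => by ring

open scoped Classical in
/-- Multiplication of an alternant by `∏ (x j + u)` raises its exponents by vertical strips: this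
is where the primed letters produce the factors `x_j + y_k`. -/
theorem prod_add_mul_alternant (u : R) {m : ℕ} (k : Fin m → ℕ) (hk : StrictAnti k)
    (hpos : ∀ i, 2 ≤ k i) :
    ∑ v ∈ Fintype.piFinset (fun i => Icc (k i - 1) (k i)) with StrictAnti v,
        (∏ i, ∏ c ∈ Ico (v i) (k i), (u - a c)) * alternant x a v =
      (∏ j ∈ range m, (x j + u)) * alternant x a (fun i => k i - 1) := by
  rw [prod_mul_alternant x a (fun j => x j + u)]
  have h := det_sum_shiftedPow x a (fun i => Icc (k i - 1) (k i))
    (fun i v => ∏ c ∈ Ico v (k i), (u - a c))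
  rw [sum_filter_of_ne]
  · rw [← h]
    congr 1
    ext i j
    obtain ⟨l, hl⟩ : ∃ l, k i = l + 1 := ⟨k i - 1, by have := hpos i; omega⟩
    have h1 : 1 ≤ l := by have := hpos i; omega
    have h2 : Icc l (l + 1) = {l, l + 1} := by
      ext; simp only [mem_Icc, mem_insert, mem_singleton]; omega
    simp only [Matrix.of_apply, hl, Nat.add_sub_cancel, h2]
    rw [sum_pair (by omega), shiftedPow_succ a _ h1]
    simp
    ring
  · intro v hv hne
    -- the exponents are weakly decreasing, and repeated ones give equal rows
    have hinj : Function.Injective v := by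
      by_contra h'
      exact hne (by rw [alternant_eq_zero x a h', mul_zero])
    refine Antitone.strictAnti_of_injective (fun i j hij => ?_) hinj
    rcases hij.eq_or_lt with rfl | hij
    · exact le_rfl
    · have h1 := mem_Icc.1 (Fintype.mem_piFinset.1 hv i)
      have h2 := mem_Icc.1 (Fintype.mem_piFinset.1 hv j)
      have h3 := hk hij
      omega

end Det

/-! ### Diagrams given by row lengths -/

section Rows
variable {R : Type*} [CommRing R]

/-- The map from pairs (row index in `Fin m`, column) to pairs of natural numbers. -/
def boxEmb (m : ℕ) : (Σ _ : Fin m, ℕ) ↪ ℕ × ℕ :=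
  ⟨fun b => ((b.1 : ℕ), b.2), by
    rintro ⟨i, j⟩ ⟨i', j'⟩ h
    simp only [Prod.mk.injEq] at h
    obtain ⟨h, rfl⟩ := h
    obtain rfl := Fin.ext h
    rfl⟩

/-- The diagram whose row `i < m` consists of the `r i` boxes in the columns
`s i, …, s i + r i - 1`. -/
def rowsDiagram (s : ℕ → ℕ) {m : ℕ} (r : Fin m → ℕ) : Finset (ℕ × ℕ) :=
  (univ.sigma fun i : Fin m => Ico (s i) (s i + r i)).map (boxEmb m)

/-- `b` lies weakly to the left of `c` in the same row or weakly above `c` in the same column. -/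
def BoxLE (b c : ℕ × ℕ) : Prop := (b.1 = c.1 ∧ b.2 ≤ c.2) ∨ (b.2 = c.2 ∧ b.1 ≤ c.1)

variable (s : ℕ → ℕ) {m : ℕ}

theorem mem_rowsDiagram {r : Fin m → ℕ} {b : ℕ × ℕ} :
    b ∈ rowsDiagram s r ↔ ∃ h : b.1 < m, s b.1 ≤ b.2 ∧ b.2 < s b.1 + r ⟨b.1, h⟩ := by
  obtain ⟨i, j⟩ := b
  simp only [rowsDiagram, mem_map, mem_sigma, mem_univ, true_and, mem_Ico]
  constructor
  · rintro ⟨⟨i', j'⟩, h, hij⟩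
    obtain ⟨rfl, rfl⟩ := Prod.mk.inj (show ((i' : ℕ), j') = (i, j) from hij)
    exact ⟨i'.2, h⟩
  · rintro ⟨h, h'⟩
    exact ⟨⟨⟨i, h⟩, j⟩, h', rfl⟩

theorem coe_mem_rowsDiagram {r : Fin m → ℕ} {i : Fin m} {j : ℕ} :
    ((i : ℕ), j) ∈ rowsDiagram s r ↔ s i ≤ j ∧ j < s i + r i := by
  simp [mem_rowsDiagram]

theorem rowsDiagram_subset_iff {r r' : Fin m → ℕ} :
    rowsDiagram s r' ⊆ rowsDiagram s r ↔ ∀ i, r' i ≤ r i := by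
  constructor
  · intro h i
    by_contra hlt
    have h1 : ((i : ℕ), s i + r i) ∈ rowsDiagram s r' := by
      rw [coe_mem_rowsDiagram]; omega
    have h2 := h h1
    rw [coe_mem_rowsDiagram] at h2
    omega
  · rintro h ⟨i, j⟩ hb
    rw [mem_rowsDiagram] at hb ⊢
    obtain ⟨hi, hb⟩ := hb
    have := h ⟨i, hi⟩
    exact ⟨hi, hb.1, by dsimp only at *; omega⟩

theorem rowsDiagram_injective : Function.Injective (rowsDiagram s (m := m)) := by
  intro r r' h
  ext i
  exact le_antisymm ((rowsDiagram_subset_iff s).1 h.subset i)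
    ((rowsDiagram_subset_iff s).1 h.symm.subset i)

theorem rowsDiagram_snoc_zero (r : Fin m → ℕ) :
    rowsDiagram s (Fin.snoc r 0 : Fin (m + 1) → ℕ) = rowsDiagram s r := by
  ext ⟨i, j⟩
  simp only [mem_rowsDiagram]
  constructor
  · rintro ⟨hi, h⟩
    by_cases him : i < m
    · refine ⟨him, ?_⟩
      simpa [Fin.snoc, him] using h
    · simp [Fin.snoc, him] at h
      omega
  · rintro ⟨hi, h⟩
    exact ⟨hi.trans (Nat.lt_succ_self m), by simpa [Fin.snoc, hi] using h⟩

theorem prod_rowsDiagram_sdiff {r r' : Fin m → ℕ} (h : ∀ i, r' i ≤ r i) (f : ℕ × ℕ → R) :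
    ∏ b ∈ rowsDiagram s r \ rowsDiagram s r', f b =
      ∏ i : Fin m, ∏ j ∈ Ico (r' i) (r i), f (i, s i + j) := by
  have : rowsDiagram s r \ rowsDiagram s r' =
      (univ.sigma fun i : Fin m => Ico (s i + r' i) (s i + r i)).map (boxEmb m) := by
    rw [rowsDiagram, rowsDiagram, ← Finset.map_sdiff]
    congr 1
    ext ⟨i, j⟩
    have := h i
    simp only [mem_sdiff, mem_sigma, mem_univ, true_and, mem_Ico]
    omega
  rw [this, prod_map, prod_sigma]
  refine prod_congr rfl fun i _ => ?_
  rw [prod_Ico_add (fun j => f (i, j)), add_comm (s i), add_comm (s i)]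
  rfl

/-- A subset of a diagram that is closed under moving to the left consists of initial segments of
the rows. -/
theorem exists_eq_rowsDiagram {r : Fin m → ℕ} {D : Finset (ℕ × ℕ)} (hD : D ⊆ rowsDiagram s r)
    (hlow : ∀ b ∈ rowsDiagram s r, ∀ c ∈ D, BoxLE b c → b ∈ D) :
    ∃ r' : Fin m → ℕ, rowsDiagram s r' = D := by
  classical
  have hex : ∀ i : Fin m, ∃ k, ((i : ℕ), s i + k) ∉ D := fun i =>
    ⟨r i, fun h => by have := (coe_mem_rowsDiagram s).1 (hD h); omega⟩
  refine ⟨fun i => Nat.find (hex i), ?_⟩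
  ext ⟨i, j⟩
  rw [mem_rowsDiagram]
  constructor
  · rintro ⟨hi, h1, h2⟩
    have := Nat.find_min (hex ⟨i, hi⟩) (m := j - s i) (by dsimp only at *; omega)
    simp only [not_not] at this
    dsimp only at h1
    rwa [Nat.add_sub_cancel' h1] at this
  · intro h
    obtain ⟨hi, h1, h2⟩ := (mem_rowsDiagram s).1 (hD h)
    refine ⟨hi, h1, ?_⟩
    by_contra hlt
    refine Nat.find_spec (hex ⟨i, hi⟩) (hlow _ ?_ _ h (Or.inl ⟨rfl, ?_⟩))
    · rw [mem_rowsDiagram]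
      exact ⟨hi, by dsimp only at *; omega, by dsimp only at *; omega⟩
    · dsimp only at *
      omega

open scoped Classical in
theorem fillingSum_rowsDiagram_succ (E : ℕ → ℕ × ℕ → ℕ × ℕ → Prop) (w : ℕ → ℕ × ℕ → R)
    (N : ℕ) (r : Fin m → ℕ) :
    fillingSum BoxLE E w (N + 1) (rowsDiagram s r) =
      ∑ r' ∈ Fintype.piFinset (fun i => Iic (r i)) with
          IsStrip BoxLE (E N) (rowsDiagram s r') (rowsDiagram s r),
        (∏ i : Fin m, ∏ j ∈ Ico (r' i) (r i), w N (i, s i + j)) *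
          fillingSum BoxLE E w N (rowsDiagram s r') := by
  rw [fillingSum_succ]
  symm
  refine sum_bij (fun r' _ => rowsDiagram s r') ?_ ?_ ?_ ?_
  · intro r' h
    simp only [mem_filter, Fintype.mem_piFinset, mem_Iic, mem_powerset] at h ⊢
    exact ⟨(rowsDiagram_subset_iff s).2 h.1, h.2⟩
  · intro r₁ _ r₂ _ h
    exact rowsDiagram_injective s h
  · intro D' h
    simp only [mem_filter, mem_powerset] at h
    obtain ⟨r', rfl⟩ := exists_eq_rowsDiagram s h.1 h.2.1
    refine ⟨r', ?_, rfl⟩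
    simp only [mem_filter, Fintype.mem_piFinset, mem_Iic]
    exact ⟨(rowsDiagram_subset_iff s).1 h.1, h.2⟩
  · intro r' h
    simp only [mem_filter, Fintype.mem_piFinset, mem_Iic] at h
    rw [prod_rowsDiagram_sdiff s h.1]

end Rows

/-! ### Horizontal and vertical strips -/

/-- The boxes lie in the same column. -/
def SameCol (b c : ℕ × ℕ) : Prop := b.2 = c.2

/-- The boxes lie in the same row. -/
def SameRow (b c : ℕ × ℕ) : Prop := b.1 = c.1

section Strips

variable {m : ℕ}

theorem antitone_add_of_strictAnti {k : Fin m → ℕ} (hk : StrictAnti k) :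
    Antitone fun i : Fin m => (i : ℕ) + k i := by
  cases m with
  | zero => exact fun i => i.elim0
  | succ m =>
    refine Fin.antitone_iff_succ_le.2 fun i => ?_
    have := hk (Fin.castSucc_lt_succ (i := i))
    simp only [Fin.val_succ, Fin.val_castSucc]
    omega

/-- Horizontal strips between diagrams whose row ends are weakly decreasing: the row ends
interlace. -/
theorem isStrip_sameCol_iff {s : ℕ → ℕ} {r r' : Fin (m + 1) → ℕ} (hs : Monotone s)
    (hr : Antitone fun i : Fin (m + 1) => s i + r i)
    (h0 : ∀ i : Fin m, s (i + 1) ≤ s i ∨ 0 < r i.succ) (hle : ∀ i, r' i ≤ r i) :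
    IsStrip BoxLE SameCol (rowsDiagram s r') (rowsDiagram s r) ↔
      ∀ i : Fin m, s (i + 1) + r i.succ ≤ s i + r' i.castSucc := by
  constructor
  · rintro ⟨hlow, hstrip⟩ i
    by_contra hlt
    -- the leftmost column that meets row `i` outside `r'` and can meet row `i + 1`
    set j := max (s i + r' i.castSucc) (s (i + 1))
    have hsi : s i ≤ s (i + 1) := hs (Nat.le_succ _)
    have hri : s (i + 1) + r i.succ ≤ s i + r i.castSucc := hr (Fin.castSucc_lt_succ (i := i)).le
    have h0i := h0 i
    have hb : ((i.castSucc : ℕ), j) ∈ rowsDiagram s r := by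
      rw [coe_mem_rowsDiagram]; simp only [Fin.val_castSucc]; omega
    have hb' : ((i.castSucc : ℕ), j) ∉ rowsDiagram s r' := by
      rw [coe_mem_rowsDiagram]; simp only [Fin.val_castSucc]; omega
    have hc : ((i.succ : ℕ), j) ∈ rowsDiagram s r := by
      rw [coe_mem_rowsDiagram]; simp only [Fin.val_succ]; omega
    have hc' : ((i.succ : ℕ), j) ∉ rowsDiagram s r' := fun h =>
      hb' (hlow _ hb _ h (Or.inr ⟨rfl, by simp⟩))
    have := hstrip _ hb hb' _ hc hc' rfl
    simp at this
  · intro h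
    have key : ∀ b c : ℕ × ℕ, b ∈ rowsDiagram s r → c ∈ rowsDiagram s r → b.2 = c.2 →
        b.1 < c.1 → b ∈ rowsDiagram s r' := by
      rintro ⟨i, j⟩ ⟨i', j'⟩ hb hc rfl hlt
      obtain ⟨hi, hb⟩ := (mem_rowsDiagram s).1 hb
      obtain ⟨hi', hc⟩ := (mem_rowsDiagram s).1 hc
      dsimp only at *
      have h1 := h ⟨i, by omega⟩
      have h2 := hr (show (⟨i, by omega⟩ : Fin m).succ ≤ ⟨i', hi'⟩ from hlt)
      rw [mem_rowsDiagram]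
      refine ⟨hi, hb.1, ?_⟩
      simp only [Fin.castSucc_mk, Fin.succ_mk] at h1 h2 ⊢
      omega
    refine ⟨?_, ?_⟩
    · rintro ⟨i, j⟩ hb ⟨i', j'⟩ hc (⟨h1, h2⟩ | ⟨h1, h2⟩)
      · obtain ⟨hi, hb⟩ := (mem_rowsDiagram s).1 hb
        obtain ⟨hi', hc⟩ := (mem_rowsDiagram s).1 hc
        dsimp only at *
        subst h1
        exact (mem_rowsDiagram s).2 ⟨hi, hb.1, by dsimp only; omega⟩
      · dsimp only at *
        subst h1
        rcases h2.eq_or_lt with rfl | h2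
        · exact hc
        · exact key _ _ hb ((rowsDiagram_subset_iff s).2 hle hc) rfl h2
    · intro b hb hb' c hc hc' hbc
      rcases lt_trichotomy b.1 c.1 with h1 | h1 | h1
      · exact absurd (key b c hb hc hbc h1) hb'
      · exact Prod.ext h1 hbc
      · exact absurd (key c b hc hb hbc.symm h1) hc'

/-- Vertical strips of a strict shape `(k, e)` that leave its last row empty. -/
theorem isStrip_sameRow_iff {k v : Fin m → ℕ} {e : ℕ} (hk : StrictAnti k) (h2 : ∀ i, 2 ≤ k i)
    (he : e ≤ 1) (hle : ∀ i, v i ≤ k i) :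
    IsStrip BoxLE SameRow (rowsDiagram id v)
      (rowsDiagram id (Fin.snoc k e : Fin (m + 1) → ℕ)) ↔
      (∀ i, k i ≤ v i + 1) ∧ StrictAnti v := by
  have hmem : ∀ (i : Fin m) (j : ℕ),
      ((i : ℕ), j) ∈ rowsDiagram id (Fin.snoc k e : Fin (m + 1) → ℕ) ↔
        (i : ℕ) ≤ j ∧ j < i + k i := by
    intro i j
    rw [← Fin.val_castSucc, coe_mem_rowsDiagram]
    simp
  have hmem' : ∀ (i : Fin m) (j : ℕ), ((i : ℕ), j) ∈ rowsDiagram id v ↔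
      (i : ℕ) ≤ j ∧ j < i + v i := fun i j => coe_mem_rowsDiagram id
  constructor
  · rintro ⟨hlow, hstrip⟩
    have h1 : ∀ i, k i ≤ v i + 1 := by
      intro i
      by_contra hlt
      have := hstrip ((i : ℕ), i + v i) (by rw [hmem]; omega) (by rw [hmem']; omega)
        ((i : ℕ), i + v i + 1) (by rw [hmem]; omega) (by rw [hmem']; omega) rfl
      simp at this
    refine ⟨h1, fun i j hij => ?_⟩
    by_contra hlt
    have hij' : (i : ℕ) < j := hij
    have hk' := antitone_add_of_strictAnti hk hij.le
    have h1j := h1 j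
    have h2j := h2 j
    have hlej := hle j
    dsimp only at hk'
    have := hlow ((i : ℕ), j + v j - 1) (by rw [hmem]; omega) ((j : ℕ), j + v j - 1)
      (by rw [hmem']; omega) (Or.inr ⟨rfl, hij'.le⟩)
    rw [hmem'] at this
    omega
  · rintro ⟨h1, hv⟩
    refine ⟨?_, ?_⟩
    · rintro ⟨i, j⟩ hb ⟨i', j'⟩ hc hbc
      obtain ⟨hi', hc⟩ := (mem_rowsDiagram id).1 hc
      obtain ⟨hi, hb⟩ := (mem_rowsDiagram id).1 hb
      have hii' : i ≤ i' := by
        rcases hbc with ⟨h, -⟩ | ⟨-, h⟩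
        · exact h.le
        · exact h
      have hjj' : j ≤ j' := by
        rcases hbc with ⟨-, h⟩ | ⟨h, -⟩
        · exact h
        · exact h.le
      dsimp only [id] at *
      have := antitone_add_of_strictAnti hv (show (⟨i, by omega⟩ : Fin m) ≤ ⟨i', hi'⟩ from hii')
      exact (mem_rowsDiagram id).2 ⟨by dsimp only; omega, hb.1, by dsimp only [id] at *; omega⟩
    · rintro ⟨i, j⟩ hb hb' ⟨i', j'⟩ hc hc' hbc
      obtain rfl : i = i' := hbc
      rw [mem_rowsDiagram] at hb hb' hc hc'
      obtain ⟨hi, hb⟩ := hb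
      obtain ⟨_, hc⟩ := hc
      simp only [id, not_exists] at hb hc hb' hc'
      by_cases him : i < m
      · have hb2 := hb' him
        have hc2 := hc' him
        have h1i := h1 ⟨i, him⟩
        simp only [Fin.snoc, him, dite_true, Fin.castLT_mk, cast_eq] at hb hc
        simp only [Prod.mk.injEq, true_and]
        omega
      · simp only [Fin.snoc, him, dite_false, cast_eq] at hb hc
        simp only [Prod.mk.injEq, true_and]
        omega

end Strips

/-! ### Factorial Schur functions as bialternants -/

section Schur
variable {R : Type*} [CommRing R] (x a : ℕ → R) {m : ℕ}

/-- The weight `x_k + a_{k + j - i}` (with `k`, `i`, `j` counted from `1`) of a letter of a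
semistandard tableau. -/
def schurWeight (k : ℕ) (b : ℕ × ℕ) : R := x k + a ((k + 1) + (b.2 + 1) - (b.1 + 1))

/-- The generating function of the semistandard tableaux with row lengths `r` and entries below
`m`. -/
noncomputable def schurSum (m : ℕ) {l : ℕ} (r : Fin l → ℕ) : R :=
  fillingSum BoxLE (fun _ => SameCol) (schurWeight x a) m (rowsDiagram 0 r)

/-- The branching rule of the factorial Schur functions. -/
theorem schurSum_succ (r : Fin (m + 1) → ℕ) (hr : Antitone r) :
    schurSum x a (m + 1) r =
      ∑ k ∈ Fintype.piFinset (fun i : Fin m => Icc (r i.succ) (r i.castSucc)),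
        (∏ i : Fin m, ∏ j ∈ Ico (k i) (r i.castSucc), (x m + a (m + 1 + j - i))) *
          (∏ j ∈ Ico 0 (r (Fin.last m)), (x m + a (j + 1))) * schurSum x a m k := by
  classical
  rw [schurSum, fillingSum_rowsDiagram_succ]
  symm
  have hstrip : ∀ r' : Fin (m + 1) → ℕ, (∀ i, r' i ≤ r i) →
      (IsStrip BoxLE SameCol (rowsDiagram 0 r') (rowsDiagram 0 r) ↔
        ∀ i : Fin m, r i.succ ≤ r' i.castSucc) := by
    intro r' hle
    rw [isStrip_sameCol_iff (fun _ _ _ => le_rfl) (by simpa using hr) (by simp) hle]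
    simp
  refine sum_of_injOn (fun k => Fin.snoc k 0) ?_ ?_ ?_ ?_
  · intro k _ k' _ h
    simpa using congrArg Fin.init h
  · intro k hk
    simp only [coe_filter, Set.mem_ofPred_eq, mem_coe, Fintype.mem_piFinset, mem_Icc,
      mem_Iic] at hk ⊢
    have hle : ∀ i : Fin (m + 1), (Fin.snoc k 0 : Fin (m + 1) → ℕ) i ≤ r i := by
      intro i
      refine Fin.lastCases ?_ (fun i => ?_) i
      · simp
      · simpa using (hk i).2
    exact ⟨hle, (hstrip _ hle).2 fun i => by simpa using (hk i).1⟩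
  · intro r' hr' hnot
    simp only [mem_filter, Fintype.mem_piFinset, mem_Iic] at hr'
    obtain ⟨hle, hs⟩ := hr'
    rw [hstrip r' hle] at hs
    -- shapes with `m + 1` nonempty rows have no column-strict filling by `m` letters
    have hlast : 0 < r' (Fin.last m) := by
      rw [Nat.pos_iff_ne_zero]
      intro h0
      refine hnot ⟨Fin.init r', ?_, ?_⟩
      · simp only [mem_coe, Fintype.mem_piFinset, mem_Icc]
        exact fun i => ⟨hs i, hle _⟩
      · dsimp only
        rw [← h0, Fin.snoc_init_self]
    rw [fillingSum_eq_zero_of_chain _ _ _ (fun t => (t, 0)) (fun t => Or.inr ⟨rfl, Nat.le_succ t⟩)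
      (fun t => rfl) (fun t => by simp), mul_zero]
    intro t ht
    rw [mem_rowsDiagram]
    refine ⟨Nat.lt_succ_of_le ht, le_rfl, ?_⟩
    rcases ht.eq_or_lt with rfl | ht
    · change 0 < 0 + r' (Fin.last t)
      omega
    · have h1 := hs ⟨t, ht⟩
      have h2 := hr (Fin.le_last (⟨t, ht⟩ : Fin m).succ)
      have h3 := hle (Fin.last m)
      simp only [Fin.succ_mk, Fin.castSucc_mk] at h1 h2
      simp
      omega
  · intro k _
    rw [rowsDiagram_snoc_zero, Fin.prod_univ_castSucc, schurSum]
    congr 2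
    · refine prod_congr rfl fun i _ => ?_
      rw [Fin.snoc_castSucc]
      refine prod_congr rfl fun j _ => ?_
      simp only [schurWeight, Fin.val_castSucc, Pi.zero_apply, zero_add]
      congr 2
      omega
    · rw [Fin.snoc_last]
      refine prod_congr rfl fun j _ => ?_
      simp only [schurWeight, Fin.val_last, Pi.zero_apply, zero_add]
      congr 2
      omega

theorem vandermondeProd_succ (m : ℕ) :
    vandermondeProd x (m + 1) = vandermondeProd x m * ∏ j ∈ range m, (x j - x m) :=
  prod_range_succ _ _

/-- The bialternant formula for factorial Schur functions. -/
theorem vandermondeProd_mul_schurSum (m : ℕ) (r : Fin m → ℕ) (hr : Antitone r) :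
    vandermondeProd x m * schurSum x a m r = alternant x a (fun i => r i + (m - i)) := by
  induction m with
  | zero =>
    have : rowsDiagram 0 r = ∅ := rfl
    rw [schurSum, this, fillingSum_empty]
    simp [vandermondeProd, alternant]
  | succ m ih =>
    rw [schurSum_succ x a r hr, vandermondeProd_succ, mul_assoc, mul_left_comm, mul_sum,
      ← alternant_succ]
    · congr 1
      refine sum_bij (fun k _ i => k i + (m - i)) ?_ ?_ ?_ ?_
      · intro k hk
        simp only [Fintype.mem_piFinset, mem_Icc, mem_Ico, Fin.val_succ, Fin.val_castSucc] at hk ⊢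
        intro i
        have := hk i
        omega
      · intro k _ k' _ h
        ext i
        have := congrFun h i
        omega
      · intro k hk
        simp only [Fintype.mem_piFinset, mem_Ico, Fin.val_succ, Fin.val_castSucc] at hk
        refine ⟨fun i => k i - (m - i), ?_, ?_⟩
        · simp only [Fintype.mem_piFinset, mem_Icc]
          intro i
          have := hk i
          omega
        · ext i
          have := hk i
          dsimp only
          omega
      · intro k hk
        simp only [Fintype.mem_piFinset, mem_Icc] at hk
        have hanti : Antitone k := by
          intro i j hij
          rcases hij.eq_or_lt with rfl | hij
          · exact le_rfl
          · refine (hk j).2.trans (le_trans (hr ?_) (hk i).1)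
            exact Fin.succ_le_castSucc_iff.2 hij
        rw [← ih k hanti]
        have h1 : ∀ i : Fin m, ∏ j ∈ Ico (k i) (r i.castSucc), (x m + a (m + 1 + j - i)) =
            ∏ c ∈ Ico (k i + (m - i) + 1) (r i.castSucc + (m + 1 - i)), (x m + a c) := by
          intro i
          have := prod_Ico_add' (fun c => x m + a c) (k i) (r i.castSucc) (m + 1 - i)
          rw [show k i + (m - i) + 1 = k i + (m + 1 - i) by omega, ← this]
          refine prod_congr rfl fun j _ => ?_
          congr 2
          omega
        have h2 : ∏ j ∈ Ico 0 (r (Fin.last m)), (x m + a (j + 1)) =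
            shiftedPow a (x m) (r (Fin.last m) + (m + 1 - m)) := by
          rw [shiftedPow, show m + 1 - m = 1 by omega,
            ← prod_Ico_add' (fun c => x m + a c) 0 _ 1]
        simp only [h1, h2, Fin.val_castSucc, Fin.val_last]
        ring
    · intro i j hij
      have h1 := hr hij
      have h2 : (i : ℕ) ≤ j := hij
      dsimp only
      omega
    · intro i
      omega

end Schur

/-! ### Primed shifted tableaux -/

section Shifted
variable {R : Type*} [CommRing R] (x y a d d' : ℕ → R) {m : ℕ}

/-- The weights of the letters of a primed shifted tableau, where `2 * k` stands for `k'` and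
`2 * k + 1` for `k`. On the diagonal the weights are arbitrary sequences `d'` (primed letters) and
`d` (unprimed letters). -/
def shiftedWeight (l : ℕ) (b : ℕ × ℕ) : R :=
  if b.1 = b.2 then (if Even l then d' (l / 2) else d (l / 2))
  else if Even l then y (l / 2) - a (b.2 - b.1) else x (l / 2) + a (b.2 - b.1)

/-- Two boxes that cannot both carry the letter `l`: boxes in one row for a primed letter
(`l` even), boxes in one column for an unprimed letter (`l` odd). -/
def ShiftedExcl (l : ℕ) : ℕ × ℕ → ℕ × ℕ → Prop := if Even l then SameRow else SameCol

/-- The generating function of the primed shifted tableaux with row lengths `r` and entries among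
the first `N` letters of the alphabet `0' < 0 < 1' < 1 < ⋯`. -/
noncomputable def shiftedSum (N : ℕ) {l : ℕ} (r : Fin l → ℕ) : R :=
  fillingSum BoxLE ShiftedExcl (shiftedWeight x y a d d') N (rowsDiagram id r)

theorem shiftedWeight_even (i : ℕ) {c : ℕ} (hc : 1 ≤ c) :
    shiftedWeight x y a d d' (2 * m) (i, i + c) = y m - a c := by
  have : i ≠ i + c := by omega
  simp [shiftedWeight]
  omega

theorem shiftedWeight_odd (i : ℕ) {c : ℕ} (hc : 1 ≤ c) :
    shiftedWeight x y a d d' (2 * m + 1) (i, i + c) = x m + a c := by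
  have h : ¬ i = i + c := by omega
  have h2 : (2 * m + 1) / 2 = m := by omega
  have h3 : ¬ Even (2 * m + 1) := by simp
  simp only [shiftedWeight, h, h2, h3, if_false, Nat.add_sub_cancel_left]

theorem shiftedWeight_even_diag (i : ℕ) :
    shiftedWeight x y a d d' (2 * m) (i, i) = d' m := by
  simp [shiftedWeight]

theorem shiftedWeight_odd_diag (i : ℕ) :
    shiftedWeight x y a d d' (2 * m + 1) (i, i) = d m := by
  have h2 : (2 * m + 1) / 2 = m := by omega
  have h3 : ¬ Even (2 * m + 1) := by simp
  simp only [shiftedWeight, h2, h3, if_true, if_false]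

/-- The boxes `(0, 0), (0, 1), (1, 1), (1, 2), …` next to the diagonal, read downwards, need
different letters. -/
theorem shiftedSum_eq_zero {N l : ℕ} (r : Fin l → ℕ)
    (h : ∀ t ≤ N, (t / 2, (t + 1) / 2) ∈ rowsDiagram id r) :
    shiftedSum x y a d d' N r = 0 := by
  refine fillingSum_eq_zero_of_chain _ _ _ (fun t => (t / 2, (t + 1) / 2)) (fun t => ?_)
    (fun t => ?_) (fun t => ?_) N _ h
  · rcases Nat.even_or_odd' t with ⟨k, rfl | rfl⟩
    · exact Or.inl ⟨by dsimp only; omega, by dsimp only; omega⟩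
    · exact Or.inr ⟨by dsimp only; omega, by dsimp only; omega⟩
  · unfold ShiftedExcl
    split_ifs with ht
    · obtain ⟨k, rfl⟩ := ht
      change (k + k) / 2 = (k + k + 1) / 2
      omega
    · obtain ⟨k, rfl⟩ := Nat.not_even_iff_odd.1 ht
      change (2 * k + 1 + 1) / 2 = (2 * k + 1 + 1 + 1) / 2
      omega
  · intro heq
    simp only [Prod.mk.injEq] at heq
    omega

/-- Removal of the largest unprimed letter. -/
theorem shiftedSum_odd_succ (r : Fin (m + 1) → ℕ) (hr : StrictAnti r) (hpos : ∀ i, 1 ≤ r i) :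
    shiftedSum x y a d d' (2 * m + 1 + 1) r =
      ∑ k ∈ Fintype.piFinset (fun i : Fin m => Ioc (r i.succ) (r i.castSucc)),
        (∏ i : Fin m, ∏ c ∈ Ico (k i) (r i.castSucc), (x m + a c)) *
          shiftedPow a (x m) (r (Fin.last m)) *
          (d m * shiftedSum x y a d d' (2 * m + 1) (Fin.snoc k 0 : Fin (m + 1) → ℕ) +
            shiftedSum x y a d d' (2 * m + 1) (Fin.snoc k 1 : Fin (m + 1) → ℕ)) := by
  classical
  have hE : ShiftedExcl (2 * m + 1) = SameCol := if_neg (by simp)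
  rw [shiftedSum, fillingSum_rowsDiagram_succ, hE]
  have hstrip : ∀ r' : Fin (m + 1) → ℕ, (∀ i, r' i ≤ r i) →
      (IsStrip BoxLE SameCol (rowsDiagram id r') (rowsDiagram id r) ↔
        ∀ i : Fin m, r i.succ < r' i.castSucc) := by
    intro r' hle
    rw [isStrip_sameCol_iff monotone_id (antitone_add_of_strictAnti hr)
      (fun i => Or.inr (hpos _)) hle]
    refine forall_congr' fun i => ?_
    simp only [id]
    omega
  have hprod : ∀ (k : Fin m → ℕ) (e : ℕ), (∀ i, 1 ≤ k i) →
      ∏ i : Fin (m + 1), ∏ j ∈ Ico ((Fin.snoc k e : Fin (m + 1) → ℕ) i) (r i),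
        shiftedWeight x y a d d' (2 * m + 1) (i, id (i : ℕ) + j) =
      (∏ i : Fin m, ∏ c ∈ Ico (k i) (r i.castSucc), (x m + a c)) *
        ∏ j ∈ Ico e (r (Fin.last m)), shiftedWeight x y a d d' (2 * m + 1) (m, m + j) := by
    intro k e hk
    rw [Fin.prod_univ_castSucc]
    simp only [Fin.snoc_castSucc, Fin.snoc_last, Fin.val_castSucc, Fin.val_last, id]
    congr 1
    refine prod_congr rfl fun i _ => prod_congr rfl fun j hj => ?_
    exact shiftedWeight_odd _ _ _ _ _ _ ((hk i).trans (mem_Ico.1 hj).1)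
  have hlast1 : ∏ j ∈ Ico 1 (r (Fin.last m)),
      shiftedWeight x y a d d' (2 * m + 1) (m, m + j) =
        shiftedPow a (x m) (r (Fin.last m)) :=
    prod_congr rfl fun j hj => shiftedWeight_odd _ _ _ _ _ _ (mem_Ico.1 hj).1
  have hlast0 : ∏ j ∈ Ico 0 (r (Fin.last m)),
      shiftedWeight x y a d d' (2 * m + 1) (m, m + j) =
        d m * shiftedPow a (x m) (r (Fin.last m)) := by
    rw [prod_eq_prod_Ico_succ_bot (hpos _), hlast1, add_zero, shiftedWeight_odd_diag]
  symm
  trans ∑ ke ∈ Fintype.piFinset (fun i : Fin m => Ioc (r i.succ) (r i.castSucc)) ×ˢ range 2,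
      (∏ i : Fin (m + 1), ∏ j ∈ Ico ((Fin.snoc ke.1 ke.2 : Fin (m + 1) → ℕ) i) (r i),
        shiftedWeight x y a d d' (2 * m + 1) (i, id (i : ℕ) + j)) *
      shiftedSum x y a d d' (2 * m + 1) (Fin.snoc ke.1 ke.2 : Fin (m + 1) → ℕ)
  · rw [sum_product]
    refine sum_congr rfl fun k hk => ?_
    have hk1 : ∀ i, 1 ≤ k i := by
      intro i
      have := mem_Ioc.1 (Fintype.mem_piFinset.1 hk i)
      omega
    rw [sum_range_succ, sum_range_one]
    dsimp only
    rw [hprod k 0 hk1, hprod k 1 hk1, hlast0, hlast1]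
    ring
  · refine sum_of_injOn (fun ke => Fin.snoc ke.1 ke.2) ?_ ?_ ?_ ?_
    · rintro ⟨k, e⟩ _ ⟨k', e'⟩ _ h
      have h1 := congrArg Fin.init h
      have h2 := congrFun h (Fin.last m)
      simp only [Fin.init_snoc, Fin.snoc_last] at h1 h2
      rw [h1, h2]
    · rintro ⟨k, e⟩ hk
      simp only [mem_coe, mem_product, Fintype.mem_piFinset, mem_Ioc, mem_range, mem_filter,
        mem_Iic] at hk ⊢
      have hle : ∀ i : Fin (m + 1), (Fin.snoc k e : Fin (m + 1) → ℕ) i ≤ r i := by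
        intro i
        refine Fin.lastCases ?_ (fun i => ?_) i
        · have := hpos (Fin.last m)
          simp only [Fin.snoc_last]
          omega
        · simpa using (hk.1 i).2
      exact ⟨hle, (hstrip _ hle).2 fun i => by simpa using (hk.1 i).1⟩
    · intro r' hr' hnot
      simp only [mem_filter, Fintype.mem_piFinset, mem_Iic] at hr'
      obtain ⟨hle, hs⟩ := hr'
      rw [hstrip r' hle] at hs
      -- two boxes in the last row make the chain of boxes next to the diagonal too long
      have hlast : 2 ≤ r' (Fin.last m) := by
        by_contra hlt
        refine hnot ⟨(Fin.init r', r' (Fin.last m)), ?_, ?_⟩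
        · simp only [mem_coe, mem_product, Fintype.mem_piFinset, mem_Ioc, mem_range]
          exact ⟨fun i => ⟨hs i, hle _⟩, by omega⟩
        · exact Fin.snoc_init_self r'
      have h2 : ∀ i, 2 ≤ r' i := by
        intro i
        refine Fin.lastCases hlast (fun i => ?_) i
        have h1 := hs i
        have h2 := hpos i.succ
        omega
      refine mul_eq_zero_of_right _ (shiftedSum_eq_zero _ _ _ _ _ _ fun t ht => ?_)
      have := h2 ⟨t / 2, by omega⟩
      exact (mem_rowsDiagram id).2 ⟨by dsimp only; omega, by dsimp only [id]; omega,
        by dsimp only [id]; omega⟩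
    · rintro ⟨k, e⟩ _
      rfl

open scoped Classical in
/-- Removal of the largest primed letter. -/
theorem shiftedSum_even_succ (k : Fin m → ℕ) (hk : StrictAnti k) (h2 : ∀ i, 2 ≤ k i) {e : ℕ}
    (he : e ≤ 1) :
    shiftedSum x y a d d' (2 * m + 1) (Fin.snoc k e : Fin (m + 1) → ℕ) =
      d' m ^ e * ∑ v ∈ Fintype.piFinset (fun i => Icc (k i - 1) (k i)) with StrictAnti v,
        (∏ i, ∏ c ∈ Ico (v i) (k i), (y m - a c)) * shiftedSum x y a d d' (2 * m) v := by
  have hE : ShiftedExcl (2 * m) = SameRow := if_pos (by simp)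
  rw [shiftedSum, fillingSum_rowsDiagram_succ, hE, mul_sum]
  symm
  refine sum_of_injOn (fun v => Fin.snoc v 0) ?_ ?_ ?_ ?_
  · intro v _ v' _ h
    simpa using congrArg Fin.init h
  · intro v hv
    simp only [mem_coe, Fintype.mem_piFinset, mem_Icc, mem_filter, mem_Iic] at hv ⊢
    refine ⟨fun i => ?_, ?_⟩
    · refine Fin.lastCases ?_ (fun i => ?_) i
      · simp
      · simpa using (hv.1 i).2
    · rw [rowsDiagram_snoc_zero, isStrip_sameRow_iff hk h2 he fun i => (hv.1 i).2]
      exact ⟨fun i => by have := (hv.1 i).1; omega, hv.2⟩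
  · intro r' hr' hnot
    simp only [mem_filter, Fintype.mem_piFinset, mem_Iic] at hr'
    obtain ⟨hle, hs⟩ := hr'
    have hlei : ∀ i : Fin m, Fin.init r' i ≤ k i := fun i => by
      simpa [Fin.init] using hle i.castSucc
    -- a nonempty last row cannot be filled with the letters below `m'`
    have hlast : 0 < r' (Fin.last m) := by
      rw [Nat.pos_iff_ne_zero]
      intro h0
      have hr' : r' = Fin.snoc (Fin.init r') 0 := by rw [← h0, Fin.snoc_init_self]
      rw [hr', rowsDiagram_snoc_zero, isStrip_sameRow_iff hk h2 he hlei] at hs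
      refine hnot ⟨Fin.init r', ?_, hr'.symm⟩
      simp only [mem_coe, mem_filter, Fintype.mem_piFinset, mem_Icc]
      exact ⟨fun i => ⟨by have := hs.1 i; omega, hlei i⟩, hs.2⟩
    obtain ⟨hlow, hstrip⟩ := hs
    have hmem : ∀ (i : Fin m) (j : ℕ),
        ((i : ℕ), j) ∈ rowsDiagram id (Fin.snoc k e : Fin (m + 1) → ℕ) ↔
          (i : ℕ) ≤ j ∧ j < i + k i := by
      intro i j
      rw [← Fin.val_castSucc, coe_mem_rowsDiagram]
      simp
    -- every row of `r'` still has its diagonal box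
    have hdiag : ∀ i ≤ m, (i, i) ∈ rowsDiagram id r' := by
      intro i hi
      rcases hi.eq_or_lt with rfl | hi
      · exact (coe_mem_rowsDiagram id (i := Fin.last i)).2 (by simpa using hlast)
      · by_contra hnot
        have h1 := h2 ⟨i, hi⟩
        have hnot' : (i, i + 1) ∉ rowsDiagram id r' := fun h =>
          hnot (hlow _ ((hmem ⟨i, hi⟩ i).2 (by dsimp only; omega)) _ h
            (Or.inl ⟨rfl, Nat.le_succ i⟩))
        have := hstrip (i, i) ((hmem ⟨i, hi⟩ i).2 (by dsimp only; omega)) hnot (i, i + 1)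
          ((hmem ⟨i, hi⟩ _).2 (by dsimp only; omega)) hnot' rfl
        simp at this
    refine mul_eq_zero_of_right _ (shiftedSum_eq_zero _ _ _ _ _ _ fun t ht => ?_)
    rcases Nat.even_or_odd' t with ⟨i, rfl | rfl⟩
    · have := hdiag i (by omega)
      rwa [show 2 * i / 2 = i by omega, show (2 * i + 1) / 2 = i by omega]
    · rw [show (2 * i + 1) / 2 = i by omega, show (2 * i + 1 + 1) / 2 = i + 1 by omega]
      have h1 := h2 ⟨i, by omega⟩
      exact hlow _ ((hmem ⟨i, by omega⟩ _).2 (by dsimp only; omega)) _ (hdiag (i + 1) (by omega))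
        (Or.inr ⟨rfl, Nat.le_succ i⟩)
  · intro v hv
    simp only [Fintype.mem_piFinset, mem_Icc, mem_filter] at hv
    rw [rowsDiagram_snoc_zero, Fin.prod_univ_castSucc, ← shiftedSum]
    simp only [Fin.snoc_castSucc, Fin.snoc_last, Fin.val_castSucc, Fin.val_last, id]
    have h1 : ∏ j ∈ Ico 0 e, shiftedWeight x y a d d' (2 * m) (m, m + j) = d' m ^ e := by
      interval_cases e
      · simp
      · simp [shiftedWeight_even_diag]
    have h3 : ∏ i : Fin m, ∏ j ∈ Ico (v i) (k i),
        shiftedWeight x y a d d' (2 * m) ((i : ℕ), i + j) =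
          ∏ i, ∏ c ∈ Ico (v i) (k i), (y m - a c) := by
      refine prod_congr rfl fun i _ => prod_congr rfl fun j hj => ?_
      have := (hv.1 i).1
      have := h2 i
      have := (mem_Ico.1 hj).1
      exact shiftedWeight_even _ _ _ _ _ _ (by omega)
    rw [h1, h3]
    ring

/-- The factor `∏ (d_k + d'_k) ∏_{j < k} (x_j + y_k)`. -/
def tokuyamaFactor (m : ℕ) : R :=
  ∏ k ∈ range m, ((d k + d' k) * ∏ j ∈ range k, (x j + y k))

/-- Up to its Vandermonde denominator, the generating function of primed shifted tableaux is an
alternant. -/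
theorem vandermondeProd_mul_shiftedSum (m : ℕ) (r : Fin m → ℕ) (hr : StrictAnti r)
    (hpos : ∀ i, 1 ≤ r i) :
    vandermondeProd x m * shiftedSum x y a d d' (2 * m) r =
      tokuyamaFactor x y d d' m * alternant x a r := by
  classical
  induction m with
  | zero =>
    have : rowsDiagram id r = ∅ := rfl
    rw [shiftedSum, this, fillingSum_empty]
    simp [vandermondeProd, alternant, tokuyamaFactor]
  | succ m ih =>
    have key : ∀ k ∈ Fintype.piFinset (fun i : Fin m => Ioc (r i.succ) (r i.castSucc)),
        vandermondeProd x m *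
          (d m * shiftedSum x y a d d' (2 * m + 1) (Fin.snoc k 0 : Fin (m + 1) → ℕ) +
            shiftedSum x y a d d' (2 * m + 1) (Fin.snoc k 1 : Fin (m + 1) → ℕ)) =
          tokuyamaFactor x y d d' (m + 1) * alternant x a fun i => k i - 1 := by
      intro k hk
      simp only [Fintype.mem_piFinset, mem_Ioc] at hk
      have hk2 : ∀ i, 2 ≤ k i := fun i => by
        have h1 := hk i
        have h2 := hpos i.succ
        omega
      have hka : StrictAnti k := by
        intro i j hij
        refine (hk j).2.trans_lt (lt_of_le_of_lt (hr.antitone ?_) (hk i).1)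
        exact Fin.succ_le_castSucc_iff.2 hij
      rw [shiftedSum_even_succ x y a d d' k hka hk2 zero_le_one,
        shiftedSum_even_succ x y a d d' k hka hk2 le_rfl]
      have hsum : vandermondeProd x m *
          ∑ v ∈ Fintype.piFinset (fun i => Icc (k i - 1) (k i)) with StrictAnti v,
            (∏ i, ∏ c ∈ Ico (v i) (k i), (y m - a c)) * shiftedSum x y a d d' (2 * m) v =
          tokuyamaFactor x y d d' m *
            ((∏ j ∈ range m, (x j + y m)) * alternant x a fun i => k i - 1) := by
        rw [← prod_add_mul_alternant x a (y m) k hka hk2, mul_sum, mul_sum]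
        refine sum_congr rfl fun v hv => ?_
        simp only [Fintype.mem_piFinset, mem_Icc, mem_filter] at hv
        rw [mul_left_comm, ih v hv.2 fun i => by
          have h1 := hk2 i
          have h2 := hv.1 i
          omega]
        ring
      rw [tokuyamaFactor, prod_range_succ, ← tokuyamaFactor]
      linear_combination (d m + d' m) * hsum
    rw [show 2 * (m + 1) = 2 * m + 1 + 1 by ring, shiftedSum_odd_succ x y a d d' r hr hpos,
      vandermondeProd_succ, mul_assoc, mul_left_comm, ← alternant_succ x a r hr.antitone hpos,
      mul_left_comm (tokuyamaFactor x y d d' (m + 1))]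
    congr 1
    rw [mul_sum, mul_sum]
    refine sum_bij (fun (k : Fin m → ℕ) _ i => k i - 1) ?_ ?_ ?_ ?_
    · intro k hk
      simp only [Fintype.mem_piFinset, mem_Ioc, mem_Ico] at hk ⊢
      intro i
      have := hk i
      omega
    · intro k hk k' hk' h
      simp only [Fintype.mem_piFinset, mem_Ioc] at hk hk'
      ext i
      have h1 := congrFun h i
      have h2 := hk i
      have h3 := hk' i
      omega
    · intro k hk
      simp only [Fintype.mem_piFinset, mem_Ico] at hk
      refine ⟨fun i => k i + 1, ?_, rfl⟩
      simp only [Fintype.mem_piFinset, mem_Ioc]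
      intro i
      have := hk i
      omega
    · intro k hk
      have hk1 : ∀ i, k i - 1 + 1 = k i := fun i => by
        have := mem_Ioc.1 (Fintype.mem_piFinset.1 hk i)
        omega
      simp only [hk1]
      linear_combination ((∏ i : Fin m, ∏ c ∈ Ico (k i) (r i.castSucc), (x m + a c)) *
        shiftedPow a (x m) (r (Fin.last m))) * key k hk

end Shifted

/-! ### Cancellation of the Vandermonde product -/

section Universal
variable {R : Type*} [CommRing R]

theorem vandermondeProd_X_ne_zero (m : ℕ) :
    vandermondeProd (fun k => (MvPolynomial.X (0, k) : MvPolynomial (Fin 5 × ℕ) ℤ)) m ≠ 0 := by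
  refine prod_ne_zero_iff.2 fun k _ => prod_ne_zero_iff.2 fun j hj => ?_
  rw [sub_ne_zero]
  intro h
  have := MvPolynomial.X_injective h
  simp only [Prod.mk.injEq, true_and] at this
  exact (mem_range.1 hj).ne this

/-- The factorisation of the generating function of primed shifted tableaux, with arbitrary
weights on the diagonal. The Vandermonde product is cancelled in the polynomial ring in all the
weights as indeterminates. -/
theorem shiftedSum_eq_tokuyamaFactor_mul_schurSum (x y a d d' : ℕ → R) {n : ℕ} (r : Fin n → ℕ)
    (hr : Antitone r) :
    shiftedSum x y a d d' (2 * n) (fun i : Fin n => r i + (n - i)) =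
      tokuyamaFactor x y d d' n * schurSum x a n r := by
  set v : Fin 5 → ℕ → MvPolynomial (Fin 5 × ℕ) ℤ := fun s k => MvPolynomial.X (s, k) with hv
  have huniv : shiftedSum (v 0) (v 1) (v 2) (v 3) (v 4) (2 * n) (fun i : Fin n => r i + (n - i)) =
      tokuyamaFactor (v 0) (v 1) (v 3) (v 4) n * schurSum (v 0) (v 2) n r := by
    refine mul_left_cancel₀ (vandermondeProd_X_ne_zero n) ?_
    change vandermondeProd (v 0) n * _ = vandermondeProd (v 0) n * _
    rw [mul_left_comm, vandermondeProd_mul_schurSum _ _ _ _ hr, vandermondeProd_mul_shiftedSum]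
    · intro i j hij
      have h1 := hr hij.le
      have h2 : (i : ℕ) < j := hij
      dsimp only
      omega
    · intro i
      omega
  set f : MvPolynomial (Fin 5 × ℕ) ℤ →+* R :=
    MvPolynomial.eval₂Hom (Int.castRingHom R) (fun p => (![x, y, a, d, d'] p.1) p.2) with hf
  have h0 : ∀ k, f (v 0 k) = x k := fun k => by simp [hf, hv]
  have h1 : ∀ k, f (v 1 k) = y k := fun k => by simp [hf, hv]
  have h2 : ∀ k, f (v 2 k) = a k := fun k => by simp [hf, hv]
  have h3 : ∀ k, f (v 3 k) = d k := fun k => by simp [hf, hv]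
  have h4 : ∀ k, f (v 4 k) = d' k := fun k => by simp [hf, hv]
  have h := congrArg f huniv
  rw [map_mul, shiftedSum, schurSum, map_fillingSum, map_fillingSum] at h
  simp only [shiftedWeight, schurWeight, tokuyamaFactor, apply_ite f, map_add, map_sub, map_mul,
    map_prod, h0, h1, h2, h3, h4] at h
  exact h

end Universal

/-! ### Comparison with the tableaux of the statement -/

section Letters
variable {R : Type*} [CommRing R] {n : ℕ}

/-- The extension of a finite sequence by `0`. -/
def extendZero (x : Fin n → R) (k : ℕ) : R := if h : k < n then x ⟨k, h⟩ else 0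

theorem extendZero_coe (x : Fin n → R) (k : Fin n) : extendZero x k = x k := by
  simp [extendZero]

theorem rowsDiagram_rowLen (μ : YoungDiagram) (hμ : μ.colLen 0 ≤ n) :
    rowsDiagram 0 (fun i : Fin n => μ.rowLen i) = μ.cells := by
  ext ⟨i, j⟩
  rw [mem_rowsDiagram, YoungDiagram.mem_cells, YoungDiagram.mem_iff_lt_rowLen]
  simp only [Pi.zero_apply, zero_le, zero_add, true_and, exists_prop, and_iff_right_iff_imp]
  intro h
  have h1 := YoungDiagram.mem_iff_lt_colLen.1 (YoungDiagram.mem_iff_lt_rowLen.2 h)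
  exact h1.trans_le ((μ.colLen_anti 0 j (Nat.zero_le j)).trans hμ)

theorem factorialSchur_eq_schurSum (μ : YoungDiagram) (hμ : μ.colLen 0 ≤ n) (x : Fin n → R)
    (a : ℕ → R) :
    factorialSchur μ x a = schurSum (extendZero x) a n (fun i : Fin n => μ.rowLen i) := by
  classical
  rw [factorialSchur, schurSum, rowsDiagram_rowLen μ hμ, fillingSum]
  refine sum_bij (fun T _ => Finsupp.onFinset μ.cells (fun b => T.1 b.1 b.2) ?_) ?_ ?_ ?_ ?_
  · intro b hb
    by_contra h
    exact hb (T.1.zeros (by simpa using h))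
  · intro T _
    simp only [mem_filter, mem_finsupp_iff, mem_range]
    refine ⟨⟨Finsupp.support_onFinset_subset, fun b hb => T.2 b.1 b.2 hb⟩, ?_, ?_⟩
    · rintro ⟨i, j⟩ hb ⟨i', j'⟩ hc (⟨h1, h2⟩ | ⟨h1, h2⟩)
      · dsimp only at *
        subst h1
        exact T.1.row_weak_of_le h2 hc
      · dsimp only at *
        subst h1
        exact T.1.col_weak h2 hc
    · rintro ⟨i, j⟩ hb ⟨i', j'⟩ hc h rfl
      simp only [Finsupp.onFinset_apply] at h
      rcases lt_trichotomy i i' with h1 | rfl | h1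
      · exact absurd h (T.1.col_strict h1 hc).ne
      · rfl
      · exact absurd h.symm (T.1.col_strict h1 hb).ne
  · intro T _ T' _ h
    refine Subtype.ext (SemistandardYoungTableau.ext fun i j => ?_)
    exact DFunLike.congr_fun h (i, j)
  · intro p hp
    simp only [mem_filter, mem_finsupp_iff, mem_range] at hp
    obtain ⟨⟨hs, hN⟩, hL, hE⟩ := hp
    refine ⟨⟨⟨fun i j => p (i, j), ?_, ?_, ?_⟩, fun i j h => hN (i, j) h⟩, mem_univ _, ?_⟩
    · intro i j1 j2 hj h
      exact hL _ (μ.up_left_mem le_rfl hj.le h) _ h (Or.inl ⟨rfl, hj.le⟩)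
    · intro i1 i2 j hi h
      have h' := μ.up_left_mem hi.le le_rfl h
      refine lt_of_le_of_ne (hL _ h' _ h (Or.inr ⟨rfl, hi.le⟩)) fun heq => ?_
      have := hE _ h' _ h heq rfl
      simp only [Prod.mk.injEq, and_true] at this
      exact hi.ne this
    · intro i j h
      by_contra h'
      exact h (hs (by simpa using h'))
    · ext b
      rfl
  · intro T _
    rw [← prod_coe_sort μ.cells]
    refine prod_congr rfl fun c _ => ?_
    rw [schurWeight, Finsupp.onFinset_apply]
    congr 1
    exact (extendZero_coe x ⟨_, T.2 c.1.1 c.1.2 c.2⟩).symm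

/-- The position of a letter in the alphabet `1' < 1 < 2' < 2 < ⋯`, counted from `0`. -/
def letterIndex (c : PrimedAlphabet n) : ℕ := 2 * (ofLex c).1 + (ofLex c).2.toNat

theorem letterIndex_strictMono : StrictMono (letterIndex (n := n)) := by
  intro b c h
  have h1 : (ofLex b).2.toNat ≤ 1 := Bool.toNat_le _
  rcases Prod.Lex.lt_iff.1 h with h | ⟨h, h'⟩
  · have : ((ofLex b).1 : ℕ) < (ofLex c).1 := h
    simp only [letterIndex]
    omega
  · have h2 : (ofLex b).2 = false ∧ (ofLex c).2 = true := Bool.lt_iff.1 h'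
    simp [letterIndex, h, h2]

theorem letterIndex_lt (c : PrimedAlphabet n) : letterIndex c < 2 * n := by
  have h1 : (ofLex c).2.toNat ≤ 1 := Bool.toNat_le _
  have h2 := (ofLex c).1.2
  simp only [letterIndex]
  omega

theorem even_letterIndex (c : PrimedAlphabet n) : Even (letterIndex c) ↔ IsPrimed c := by
  unfold letterIndex IsPrimed
  cases (ofLex c).2
  · simp
  · simp

theorem letterIndex_div_two (c : PrimedAlphabet n) : letterIndex c / 2 = (ofLex c).1 := by
  have h1 : (ofLex c).2.toNat ≤ 1 := Bool.toNat_le _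
  simp only [letterIndex]
  omega

theorem exists_letterIndex_eq {l : ℕ} (hl : l < 2 * n) :
    ∃ c : PrimedAlphabet n, letterIndex c = l := by
  rcases Nat.even_or_odd' l with ⟨k, rfl | rfl⟩
  · exact ⟨toLex (⟨k, by omega⟩, false), by simp [letterIndex]⟩
  · exact ⟨toLex (⟨k, by omega⟩, true), by simp [letterIndex]⟩

end Letters

section PrimedTableaux
variable {R : Type*} [CommRing R] {n : ℕ} {lam : Fin n → ℕ}

theorem boxEmb_mem (b : shiftedDiagram lam) : boxEmb n b.1 ∈ rowsDiagram id lam :=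
  mem_map_of_mem _ b.2

theorem exists_boxEmb_eq {b : ℕ × ℕ} (hb : b ∈ rowsDiagram id lam) :
    ∃ c : shiftedDiagram lam, boxEmb n c.1 = b := by
  obtain ⟨c, hc, rfl⟩ := mem_map.1 hb
  exact ⟨⟨c, hc⟩, rfl⟩

/-- Primed shifted tableaux are the fillings of the diagram by indices of letters. -/
theorem isFilling_iff {p : shiftedDiagram lam → PrimedAlphabet n} {q : ℕ × ℕ → ℕ}
    (hq : ∀ b, q (boxEmb n b.1) = letterIndex (p b)) :
    IsFilling BoxLE ShiftedExcl (rowsDiagram id lam) q ↔ IsPrimedShiftedTableau p := by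
  have hfst : ∀ b c : shiftedDiagram lam, (boxEmb n b.1).1 = (boxEmb n c.1).1 ↔ b.1.1 = c.1.1 :=
    fun b c => Fin.val_inj
  have hinj : ∀ b c : shiftedDiagram lam, boxEmb n b.1 = boxEmb n c.1 ↔ b = c :=
    fun b c => (boxEmb n).injective.eq_iff.trans Subtype.ext_iff.symm
  constructor
  · rintro ⟨hL, hE⟩
    refine ⟨fun b c h h' => ?_, fun b c h h' => ?_, fun b c h hp h' => ?_, fun b c h hp h' => ?_⟩
    · have := hL _ (boxEmb_mem b) _ (boxEmb_mem c) (Or.inl ⟨(hfst b c).2 h, h'⟩)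
      rwa [hq, hq, letterIndex_strictMono.le_iff_le] at this
    · have := hL _ (boxEmb_mem b) _ (boxEmb_mem c) (Or.inr ⟨h, h'⟩)
      rwa [hq, hq, letterIndex_strictMono.le_iff_le] at this
    · refine (hinj b c).1 (hE _ (boxEmb_mem b) _ (boxEmb_mem c) (by rw [hq, hq, hp]) ?_)
      rw [hq, ShiftedExcl, if_pos ((even_letterIndex _).2 h')]
      exact (hfst b c).2 h
    · refine (hinj b c).1 (hE _ (boxEmb_mem b) _ (boxEmb_mem c) (by rw [hq, hq, hp]) ?_)
      rw [hq, ShiftedExcl, if_neg (fun h => h' ((even_letterIndex _).1 h))]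
      exact h
  · rintro ⟨h1, h2, h3, h4⟩
    refine ⟨fun b hb c hc hbc => ?_, fun b hb c hc hbc hE => ?_⟩
    · obtain ⟨b, rfl⟩ := exists_boxEmb_eq hb
      obtain ⟨c, rfl⟩ := exists_boxEmb_eq hc
      rw [hq, hq, letterIndex_strictMono.le_iff_le]
      rcases hbc with ⟨h, h'⟩ | ⟨h, h'⟩
      · exact h1 b c ((hfst b c).1 h) h'
      · exact h2 b c h h'
    · obtain ⟨b, rfl⟩ := exists_boxEmb_eq hb
      obtain ⟨c, rfl⟩ := exists_boxEmb_eq hc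
      rw [hq, hq] at hbc
      rw [hq, ShiftedExcl] at hE
      rw [hinj]
      split_ifs at hE with h
      · exact h3 b c ((hfst b c).1 hE) (letterIndex_strictMono.injective hbc)
          ((even_letterIndex _).1 h)
      · exact h4 b c hE (letterIndex_strictMono.injective hbc)
          fun h' => h ((even_letterIndex _).2 h')

/-- The generating function of primed shifted tableaux in terms of the tableaux themselves. -/
theorem sum_isPrimedShiftedTableau (x y a d d' : ℕ → R) :
    ∑ p : shiftedDiagram lam → PrimedAlphabet n with IsPrimedShiftedTableau p,
      ∏ b : shiftedDiagram lam, shiftedWeight x y a d d' (letterIndex (p b)) (boxEmb n b.1) =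
    shiftedSum x y a d d' (2 * n) lam := by
  classical
  rw [shiftedSum, fillingSum]
  set F : (shiftedDiagram lam → PrimedAlphabet n) → ℕ × ℕ → ℕ := fun p b =>
    if h : ∃ c : shiftedDiagram lam, boxEmb n c.1 = b then letterIndex (p h.choose) else 0 with hF
  have hFp : ∀ p (b : shiftedDiagram lam), F p (boxEmb n b.1) = letterIndex (p b) := by
    intro p b
    have h : ∃ c : shiftedDiagram lam, boxEmb n c.1 = boxEmb n b.1 := ⟨b, rfl⟩
    have : h.choose = b := Subtype.ext ((boxEmb n).injective h.choose_spec)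
    simp only [hF, dif_pos h, this]
  refine sum_bij (fun p _ => Finsupp.onFinset (rowsDiagram id lam) (F p) ?_) ?_ ?_ ?_ ?_
  · intro b hb
    by_contra h
    refine hb (dif_neg ?_)
    rintro ⟨c, rfl⟩
    exact h (boxEmb_mem c)
  · intro p hp
    simp only [mem_filter, mem_univ, true_and] at hp
    simp only [mem_filter, mem_finsupp_iff, mem_range]
    refine ⟨⟨Finsupp.support_onFinset_subset, fun b hb => ?_⟩, (isFilling_iff (hFp p)).2 hp⟩
    obtain ⟨c, rfl⟩ := exists_boxEmb_eq hb
    rw [Finsupp.onFinset_apply, hFp]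
    exact letterIndex_lt _
  · intro p _ p' _ h
    ext1 b
    refine letterIndex_strictMono.injective ?_
    rw [← hFp, ← hFp]
    exact DFunLike.congr_fun h _
  · intro q hq
    simp only [mem_filter, mem_finsupp_iff, mem_range] at hq
    obtain ⟨⟨hs, hN⟩, hfill⟩ := hq
    choose p hp using fun b : shiftedDiagram lam => exists_letterIndex_eq (hN _ (boxEmb_mem b))
    refine ⟨p, ?_, ?_⟩
    · simp only [mem_filter, mem_univ, true_and]
      exact (isFilling_iff fun b => (hp b).symm).1 hfill
    · ext b
      rw [Finsupp.onFinset_apply]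
      by_cases hb : b ∈ rowsDiagram id lam
      · obtain ⟨c, rfl⟩ := exists_boxEmb_eq hb
        rw [hFp, hp]
      · have h1 : q b = 0 := by
          by_contra h'
          exact hb (hs (by simpa using h'))
        rw [h1]
        refine dif_neg ?_
        rintro ⟨c, rfl⟩
        exact hb (boxEmb_mem c)
  · intro p _
    refine Eq.trans ?_ (prod_map (shiftedDiagram lam) (boxEmb n) fun b =>
      shiftedWeight x y a d d' (F p b) b).symm
    refine Eq.trans ?_ (prod_coe_sort (shiftedDiagram lam) fun b =>
      shiftedWeight x y a d d' (F p (boxEmb n b)) (boxEmb n b))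
    exact prod_congr rfl fun b _ => by rw [hFp]

/-- Off the diagonal the weights are those of `tableauWeight`. -/
theorem letterWeight_eq_of_ne (x y : Fin n → R) (a d d' : ℕ → R) (c : PrimedAlphabet n)
    (b : shiftedDiagram lam) (hb : b.1.2 ≠ (b.1.1 : ℕ)) :
    letterWeight x y (a (b.1.2 - (b.1.1 : ℕ))) c =
      shiftedWeight (extendZero x) (extendZero y) a d d' (letterIndex c) (boxEmb n b.1) := by
  have h : ¬ (boxEmb n b.1).1 = (boxEmb n b.1).2 := fun h => hb h.symm
  rw [shiftedWeight, if_neg h, letterIndex_div_two, extendZero_coe, extendZero_coe, letterWeight]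
  simp only [even_letterIndex]
  rfl

theorem shiftedWeight_eq_of_eq (x y a d d' : ℕ → R) (c : PrimedAlphabet n)
    (b : shiftedDiagram lam) (hb : b.1.2 = (b.1.1 : ℕ)) :
    shiftedWeight x y a d d' (letterIndex c) (boxEmb n b.1) =
      if IsPrimed c then d' (ofLex c).1 else d (ofLex c).1 := by
  have h : (boxEmb n b.1).1 = (boxEmb n b.1).2 := hb.symm
  rw [shiftedWeight, if_pos h, letterIndex_div_two]
  simp only [even_letterIndex]

theorem factorialQ_eq_shiftedSum (x y : Fin n → R) (a : ℕ → R) :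
    factorialQ lam x y a = shiftedSum (extendZero x) (extendZero y) a
      (fun k => extendZero x k + a 0) (fun k => extendZero y k - a 0) (2 * n) lam := by
  rw [factorialQ, ← sum_isPrimedShiftedTableau]
  refine sum_congr rfl fun p _ => prod_congr rfl fun b _ => ?_
  by_cases hb : b.1.2 = (b.1.1 : ℕ)
  · rw [shiftedWeight_eq_of_eq _ _ _ _ _ _ _ hb, letterWeight, hb, Nat.sub_self, extendZero_coe,
      extendZero_coe]
  · exact letterWeight_eq_of_ne _ _ _ _ _ _ _ hb

theorem factorialP_eq_shiftedSum (x y : Fin n → R) (a : ℕ → R) :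
    factorialP lam x y a = shiftedSum (extendZero x) (extendZero y) a
      (extendZero x) 0 (2 * n) lam := by
  rw [factorialP, ← sum_isPrimedShiftedTableau, ← filter_filter, sum_filter]
  refine sum_congr rfl fun p _ => ?_
  split_ifs with hp
  · refine prod_congr rfl fun b _ => ?_
    by_cases hb : b.1.2 = (b.1.1 : ℕ)
    · rw [shiftedWeight_eq_of_eq _ _ _ _ _ _ _ hb, letterWeight, hb, Nat.sub_self,
        if_neg (hp b hb), if_neg (hp b hb), extendZero_coe, Function.update_self, add_zero]
    · have hlt : (b.1.1 : ℕ) ≤ b.1.2 := (mem_Ico.1 (mem_sigma.1 b.2).2).1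
      rw [Function.update_of_ne (by omega)]
      exact letterWeight_eq_of_ne _ _ _ _ _ _ _ hb
  · -- a primed letter on the diagonal has the weight `0`
    simp only [DiagonalUnprimed, not_forall, not_not] at hp
    obtain ⟨b, hb, hp⟩ := hp
    refine (prod_eq_zero (mem_univ b) ?_).symm
    rw [shiftedWeight_eq_of_eq _ _ _ _ _ _ _ hb, if_pos hp]
    rfl

theorem tokuyamaFactor_extendZero (x y : Fin n → R) (d d' : ℕ → R) :
    tokuyamaFactor (extendZero x) (extendZero y) d d' n =
      (∏ i : Fin n, (d i + d' i)) * ∏ i : Fin n, ∏ j ∈ Ioi i, (x i + y j) := by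
  rw [tokuyamaFactor, prod_mul_distrib, ← Fin.prod_univ_eq_prod_range,
    ← Fin.prod_univ_eq_prod_range (fun k => ∏ j ∈ range k, (extendZero x j + extendZero y k))]
  congr 1
  rw [prod_comm' (s := univ) (t := fun i : Fin n => Ioi i) (t' := univ) (s' := fun j => Iio j)
    (by simp)]
  refine prod_congr rfl fun k _ => ?_
  rw [← Nat.Iio_eq_range, ← Fin.map_valEmbedding_Iio, prod_map]
  exact prod_congr rfl fun j _ => by
    rw [Fin.valEmbedding_apply, extendZero_coe, extendZero_coe]

end PrimedTableaux

end FactorialSchur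


theorem mainTheorem1 {R : Type*} [CommRing R] (n : ℕ) (μ : YoungDiagram)
    (hμ : μ.colLen 0 ≤ n) (x y : Fin n → R) (a : ℕ → R) :
    (StrictAnti (FactorialSchur.addStaircase n μ) ∧
      ∀ i : Fin n, 0 < FactorialSchur.addStaircase n μ i) ∧
    FactorialSchur.factorialP (FactorialSchur.addStaircase n μ) x y a =
      (∏ i : Fin n, x i) * (∏ i : Fin n, ∏ j ∈ Finset.Ioi i, (x i + y j)) *
        FactorialSchur.factorialSchur μ x a ∧
    FactorialSchur.factorialQ (FactorialSchur.addStaircase n μ) x y a =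
      (∏ i : Fin n, ∏ j ∈ Finset.Ici i, (x i + y j)) *
        FactorialSchur.factorialSchur μ x a := by
  open FactorialSchur in
  have hanti : Antitone fun i : Fin n => μ.rowLen i := fun i j hij => μ.rowLen_anti i j hij
  refine ⟨⟨fun i j hij => ?_, fun i => ?_⟩, ?_, ?_⟩
  · have h1 := hanti hij.le
    have h2 : (i : ℕ) < j := hij
    simp only [addStaircase] at h1 ⊢
    omega
  · simp only [addStaircase]
    omega
  · rw [factorialP_eq_shiftedSum, factorialSchur_eq_schurSum μ hμ]
    refine (shiftedSum_eq_tokuyamaFactor_mul_schurSum _ _ _ _ _ _ hanti).trans ?_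
    rw [tokuyamaFactor_extendZero]
    simp [extendZero_coe]
  · rw [factorialQ_eq_shiftedSum, factorialSchur_eq_schurSum μ hμ]
    refine (shiftedSum_eq_tokuyamaFactor_mul_schurSum _ _ _ _ _ _ hanti).trans ?_
    rw [tokuyamaFactor_extendZero, ← Finset.prod_mul_distrib]
    congr 1
    refine Finset.prod_congr rfl fun i _ => ?_
    rw [← Finset.Ioi_insert, Finset.prod_insert (by simp)]
    simp [extendZero_coe]
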